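/- Let $r,s\ge 2$. **The free group $F$.** Let $Y_1,\dots,Y_n$ be a Hall basis of the free nilpotent real Lie algebra of rank $r$ and step $s$: the first $r$ elements $Y_1,\dots,Y_r$ are the generators, of degree $1$; the elements are ordered compatibly with the degree; and $[Y_i,Y_j]$ is an element of the basis, of degree $d(i)+d(j)$, if and only if $d(i)+d(j)\le s$, $i>j$ and, in case $Y_i$ was constructed as $[Y_h,Y_k]$, $k\le j$. Every $Y_\ell$ is uniquely of the form $[\cdots[[Y_{\ell_0},Y_{\ell_1}],Y_{\ell_2}],\dots,Y_{\ell_h}]$ with $\ell_0\le r$; let $I(\ell)\in\mathbb N^n$ be given by $I(\ell)_j=\#\{p\ge 1:\ell_p=j\}$. Realize this Lie algebra by vector fields on $\mathbb R^n$ by putting $$Y_i(x)=\sum_{\ell:\ \ell_0=i}\frac{(-1)^{|I(\ell)|}}{I(\ell)!}\,x^{I(\ell)}\,\frac{\partial}{\partial x_\ell},\qquad i=1,\dots,r,$$ and defining $Y_{r+1},\dots,Y_n$ as the corresponding iterated commutators (Hall–Grayson–Grossman basis). Let $F=\mathbb R^n$ be the free nilpotent Lie group of rank $r$ and step $s$,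 with the group law with identity $0$ for which $Y_1,\dots,Y_n$ are left invariant. For $\alpha\in\mathbb N^n$ let $[Y_i,Y_\alpha]$ be the iterated commutator obtained from $Y_i$ by bracketing on the right $\alpha_1$ times with $Y_1$, then $\alpha_2$ times with $Y_2$, ..., finally $\alpha_n$ times with $Y_n$; write $[Y_i,Y_\alpha]=\sum_{k=1}^n c_{i\alpha}^kY_k$ with $c_{i\alpha}^k\in\mathbb R$. For $v\in\mathbb R^n$ the extremal polynomials are $$P_i^v(x)=\sum_{\alpha\in\mathbb N^n}\frac{(-1)^{|\alpha|}}{\alpha!}\Big(\sum_{k=1}^nc_{i\alpha}^kv_k\Big)x^\alpha,\qquad i=1,\dots,n .$$ **The stratified group $G$.** Let $G=\mathbb R^m$ be a stratified Lie group with identity $0$, of rank $r$ and step $s$: its Lie algebra is $\mathfrak g=\mathfrak g_1\oplus\dots\oplus\mathfrak g_s$ with $\mathfrak g_{i+1}=[\mathfrak g_1,\mathfrak g_i]$ for all $i\ge1$, $\mathfrak g_i=0$ for $i>s$, $\mathfrak g_s\ne0$ and $\dim\mathfrak g_1=r$. Let $\pi:F\to G$ be a surjective Lie group homomorphism with $\pi_*Y_i\in\mathfrak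 g_1$ for $i=1,\dots,r$. Let $s_1<\dots<s_m$ be indices in $\{1,\dots,n\}$ such that $X_i=\pi_*Y_{s_i}$, $i=1,\dots,m$, form a basis of $\mathfrak g$, let $\theta_1,\dots,\theta_m$ be the dual frame of $1$-forms, and let $\zeta_{ij}\in\mathbb R$ be the constants with $\pi_*Y_i=\sum_{j=1}^m\zeta_{ij}X_j$, $i=1,\dots,n$. **The curves.** Let $\gamma:[0,1]\to G$ be a horizontal curve with $\gamma(0)=0$, that is, a Lipschitz curve with $\dot\gamma=\sum_{j=1}^rh_j\,(\pi_*Y_j)(\gamma)$ a.e. for some controls $h\in L^\infty([0,1];\mathbb R^r)$, and let $\kappa:[0,1]\to F$ be its lift: the Lipschitz curve with $\kappa(0)=0$ and $\dot\kappa=\sum_{j=1}^rh_jY_j(\kappa)$ a.e. Suppose that $\gamma$ is an extremal (normal or abnormal) with dual curve $\xi$: there are $\xi_0\in\{0,1\}$ and a Lipschitz curve $\xi:[0,1]\to\mathbb R^m$ such that $\xi_0+|\xi|\neq0$ on $[0,1]$, and, for all $j=1,\dots,r$ and $k=1,\dots,m$, a.e. on $[0,1]$, $$\xi_0h_j+\langle\xi,(\pi_*Y_j)(\gamma)\rangle=0,\qquad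 \dot\xi_k=-\sum_{j=1}^r\sum_{i=1}^m\frac{\partial(\pi_*Y_j)_i}{\partial x_k}(\gamma)\,h_j\,\xi_i .$$ Let $\lambda_1,\dots,\lambda_m$ be the coordinates of the dual curve in the frame $\theta_1,\dots,\theta_m$, i.e. $\xi=\sum_{i=1}^m\lambda_i\,\theta_i(\gamma)$ on $[0,1]$. **Theorem.** There is $v\in\mathbb R^n$ such that $$v_i=\sum_{j=1}^m\zeta_{ij}\,v_{s_j}\quad\text{for all } i=1,\dots,n,$$ and $$\lambda_i(t)=P^v_{s_i}(\kappa(t))\quad\text{for all } t\in[0,1],\ i=1,\dots,m .$$ -/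

import Mathlib

open Set MeasureTheory
open scoped ContDiff NNReal

/-- Points, vectors and covectors of `ℝⁿ` in the standard coordinates. Only the vector space
structure and the topology matter, so any of the equivalent norms will do. -/
abbrev Vec (n : ℕ) : Type := Fin n → ℝ

/-! ### Lie groups on `ℝⁿ` and their Lie algebras -/

/-- A smooth group law on the manifold `ℝⁿ` whose identity element is the origin. -/
structure LieGroupLaw (n : ℕ) where
  mul : Vec n → Vec n → Vec n
  inv : Vec n → Vec n
  contDiff_mul : ContDiff ℝ ∞ (fun p : Vec n × Vec n => mul p.1 p.2)
  contDiff_inv : ContDiff ℝ ∞ inv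
  mul_assoc : ∀ x y z, mul (mul x y) z = mul x (mul y z)
  zero_mul : ∀ x, mul 0 x = x
  mul_zero : ∀ x, mul x 0 = x
  inv_mul : ∀ x, mul (inv x) x = 0

/-- The Lie algebra of the group: the vector fields `X` invariant under all left translations
`y ↦ x · y`. The bracket is the commutator `VectorField.lieBracket` of vector fields. -/
def LieGroupLaw.lieAlg {n : ℕ} (G : LieGroupLaw n) : Submodule ℝ (Vec n → Vec n) where
  carrier := {X | ∀ x y, X (G.mul x y) = fderiv ℝ (G.mul x) y (X y)}
  zero_mem' := by intro x y; simp
  add_mem' := by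
    intro X Y hX hY x y
    simp only [Pi.add_apply, map_add, hX x y, hY x y]
  smul_mem' := by
    intro c X hX x y
    simp only [Pi.smul_apply, map_smul, hX x y]

/-- `V 1, …, V s` is a stratification of step `s` and rank `r` of the Lie algebra `𝔤` of `G`:
`𝔤 = V 1 ⊕ ⋯ ⊕ V s`, `V (i + 1) = [V 1, V i]` for all `i ≥ 1`, `V i = 0` for `i > s`, `V s ≠ 0` and
`dim V 1 = r`. (The entry `V 0` is a dummy and is set to zero.) -/
structure LieGroupLaw.IsStratification {m : ℕ} (G : LieGroupLaw m) (r s : ℕ)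
    (V : ℕ → Submodule ℝ (Vec m → Vec m)) : Prop where
  zero_layer : V 0 = ⊥
  indep : iSupIndep V
  iSup_eq : ⨆ i, V i = G.lieAlg
  bracket : ∀ i, 1 ≤ i → V (i + 1) =
    Submodule.span ℝ {Z | ∃ X ∈ V 1, ∃ Y ∈ V i, Z = VectorField.lieBracket ℝ X Y}
  eq_bot : ∀ i, s < i → V i = ⊥
  ne_bot : V s ≠ ⊥
  rank_eq : Module.finrank ℝ (V 1) = r

/-- `π` is a homomorphism of Lie groups. -/
structure IsLieGroupHom {n m : ℕ} (F : LieGroupLaw n) (G : LieGroupLaw m)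
    (π : Vec n → Vec m) : Prop where
  contDiff : ContDiff ℝ ∞ π
  map_mul : ∀ x y, π (F.mul x y) = G.mul (π x) (π y)

/-- The differential `π_* : 𝔣 → 𝔤` of a homomorphism `π : F → G`: it sends `Y ∈ 𝔣` to the
left invariant vector field on `G` whose value at the identity is `dπ₀ (Y 0)`. -/
noncomputable def pushLie {n m : ℕ} (G : LieGroupLaw m) (π : Vec n → Vec m) (Y : Vec n → Vec n) :
    Vec m → Vec m :=
  fun y => fderiv ℝ (G.mul y) 0 (fderiv ℝ π 0 (Y 0))

/-! ### Hall bases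

An element of a Hall basis is recorded by the way it was built from the generators, that is by a
bracket expression: a generator `FreeMagma.of a`, or the bracket `t * u` of two expressions. The
degree is the number of generators in it, `FreeMagma.length`. -/

/-- `e 0, …, e (n - 1)` is a Hall basis of the free nilpotent Lie algebra of rank `r` and step `s`,
as it comes out of Hall's algorithm: it begins with the `r` generators, it is ordered by degree,
and `[X_i, X_j]` belongs to the basis exactly if its degree is at most `s`, `i > j`, and `k ≤ j` in
case `X_i` was built as `[X_h, X_k]`. -/
structure IsHallBasis (r s n : ℕ) (e : Fin n → FreeMagma (Fin r)) : Prop where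
  injective : Function.Injective e
  gen : ∀ a : Fin r, ∃ i : Fin n, (i : ℕ) = (a : ℕ) ∧ e i = FreeMagma.of a
  order : ∀ i j, (e i).length < (e j).length → i < j
  bracket : ∀ t u : FreeMagma (Fin r), (∃ l, e l = t * u) ↔
    t.length + u.length ≤ s ∧
      ∃ i j, e i = t ∧ e j = u ∧ j < i ∧ ∀ h k, e i = e h * e k → k ≤ j

/-- The generator `ℓ₀` in `t = [⋯[[ℓ₀, ℓ₁], ℓ₂], ⋯, ℓ_h]`. -/
def hallHead {r : ℕ} : FreeMagma (Fin r) → Fin r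
  | FreeMagma.of a => a
  | FreeMagma.mul t _ => hallHead t

/-- The number of `p ≥ 1` with `ℓ_p = w` in `t = [⋯[[ℓ₀, ℓ₁], ℓ₂], ⋯, ℓ_h]`, `ℓ₀` a generator. -/
def hallCount {r : ℕ} (w : FreeMagma (Fin r)) : FreeMagma (Fin r) → ℕ
  | FreeMagma.of _ => 0
  | FreeMagma.mul t u => hallCount w t + if u = w then 1 else 0

/-- The multi-index `I(ℓ)`. -/
def hallIndex {r n : ℕ} (e : Fin n → FreeMagma (Fin r)) (l : Fin n) : Fin n → ℕ :=
  fun j => hallCount (e j) (e l)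

/-- The factorial `α! = ∏ j, α_j!` of a multi-index. -/
def multiFactorial {n : ℕ} (α : Fin n → ℕ) : ℕ := ∏ j, (α j).factorial

/-- The monomial `x^α`. -/
def monom {n : ℕ} (α : Fin n → ℕ) (x : Vec n) : ℝ := ∏ j, x j ^ α j

/-- The Grayson–Grossman generators on `ℝⁿ`: the sum over the `ℓ` with `ℓ₀ = a` of
`(-1)^|I(ℓ)| / I(ℓ)! * x^I(ℓ) ∂/∂x_ℓ`. -/
noncomputable def ggField {r n : ℕ} (e : Fin n → FreeMagma (Fin r)) (a : Fin r) :
    Vec n → Vec n :=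
  fun x l => if hallHead (e l) = a then
    (-1 : ℝ) ^ (∑ j, hallIndex e l j) / (multiFactorial (hallIndex e l) : ℝ) *
      monom (hallIndex e l) x
  else 0

/-- The vector field on `ℝⁿ` obtained from a bracket expression by putting the Grayson–Grossman
generators for the letters. -/
noncomputable def bracketField {r n : ℕ} (e : Fin n → FreeMagma (Fin r)) :
    FreeMagma (Fin r) → Vec n → Vec n
  | FreeMagma.of a => ggField e a
  | FreeMagma.mul t u => VectorField.lieBracket ℝ (bracketField e t) (bracketField e u)

/-- The Hall–Grayson–Grossman basis `Y_1, …, Y_n` of vector fields on `ℝⁿ`. -/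
noncomputable def hggField {r n : ℕ} (e : Fin n → FreeMagma (Fin r)) (i : Fin n) :
    Vec n → Vec n :=
  bracketField e (e i)

/-- `F` is the free nilpotent Lie group, identified with `ℝⁿ` so that its Lie algebra has the
Hall–Grayson–Grossman fields of `e` as a basis of left invariant fields. -/
def IsFreeNilpotentLaw {r n : ℕ} (e : Fin n → FreeMagma (Fin r)) (F : LieGroupLaw n) : Prop :=
  ∀ i, hggField e i ∈ F.lieAlg

/-! ### Generalized structure constants and extremal polynomials -/

/-- The iterated commutator `[W, Y_α]`: bracketing on the right `α_1` times with `Y_1`, then `α_2`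
times with `Y_2`, and so on, finally `α_n` times with `Y_n`. -/
noncomputable def iterBracket {n : ℕ} (Y : Fin n → Vec n → Vec n) (W : Vec n → Vec n)
    (α : Fin n → ℕ) : Vec n → Vec n :=
  (List.finRange n).foldl (fun V j => (fun U => VectorField.lieBracket ℝ U (Y j))^[α j] V) W

open Classical in
/-- The constants `c_1, …, c_n` with `W = ∑ k, c_k Y_k` (zero if there are none; they are unique
when `Y` is linearly independent). -/
noncomputable def frameCoeff {n : ℕ} (Y : Fin n → Vec n → Vec n) (W : Vec n → Vec n) :
    Fin n → ℝ :=
  if h : ∃ c : Fin n → ℝ, W = ∑ k, c k • Y k then h.choose else 0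

/-- The generalized structure constants: `[Y_i, Y_α] = ∑ k, c^k_{iα} Y_k`. -/
noncomputable def genStructConst {n : ℕ} (Y : Fin n → Vec n → Vec n) (i : Fin n)
    (α : Fin n → ℕ) (k : Fin n) : ℝ :=
  frameCoeff Y (iterBracket Y (Y i) α) k

/-- `φ_{iα}(v) = (-1)^|α| / α! * ∑ k, c^k_{iα} v_k`. -/
noncomputable def extremalCoeff {n : ℕ} (Y : Fin n → Vec n → Vec n) (i : Fin n)
    (α : Fin n → ℕ) (v : Vec n) : ℝ :=
  (-1 : ℝ) ^ (∑ j, α j) / (multiFactorial α : ℝ) * ∑ k, genStructConst Y i α k * v k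

/-- The extremal polynomial `P_i^v(x) = ∑ α, φ_{iα}(v) x^α`, a finite sum over all multi-indices
`α ∈ ℕⁿ` because `φ_{iα} = 0` for large `|α|`. -/
noncomputable def extremalPoly {n : ℕ} (Y : Fin n → Vec n → Vec n) (v : Vec n) (i : Fin n)
    (x : Vec n) : ℝ :=
  ∑ᶠ α : Fin n → ℕ, extremalCoeff Y i α v * monom α x

/-! ### Horizontal curves, extremals and dual curves

Curves `[0,1] → ℝᵐ` are functions on `ℝ` of which only the values on `[0,1]` are used. -/

/-- `γ : [0,1] → ℝᵐ` is a Lipschitz curve, horizontal for `X_1, …, X_r` with controls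
`h ∈ L^∞([0,1]; ℝʳ)`. -/
structure IsHorizontal {m r : ℕ} (X : Fin r → Vec m → Vec m) (γ : ℝ → Vec m)
    (h : ℝ → Fin r → ℝ) : Prop where
  lipschitz : ∃ K : ℝ≥0, LipschitzOnWith K γ (Icc 0 1)
  control : MemLp h ⊤ (volume.restrict (Icc (0 : ℝ) 1))
  deriv : ∀ᵐ t ∂(volume.restrict (Icc (0 : ℝ) 1)),
    HasDerivAt γ (∑ j, h t j • X j (γ t)) t

/-- The pairing of a covector with a vector. -/
def pair {m : ℕ} (ξ w : Vec m) : ℝ := ∑ k, ξ k * w k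

/-- `ξ` is a dual curve, with multiplier `ξ₀ ∈ {0, 1}`, of the horizontal curve `γ` with
controls `h`; its existence makes `γ` an extremal, normal if `ξ₀ = 1` and abnormal if `ξ₀ = 0`. -/
structure IsDualCurve {m r : ℕ} (X : Fin r → Vec m → Vec m) (γ : ℝ → Vec m)
    (h : ℝ → Fin r → ℝ) (ξ₀ : ℝ) (ξ : ℝ → Vec m) : Prop where
  multiplier : ξ₀ = 0 ∨ ξ₀ = 1
  lipschitz : ∃ K : ℝ≥0, LipschitzOnWith K ξ (Icc 0 1)
  nontrivial : ∀ t ∈ Icc (0 : ℝ) 1, ξ₀ + ‖ξ t‖ ≠ 0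
  maximum : ∀ j, ∀ᵐ t ∂(volume.restrict (Icc (0 : ℝ) 1)),
    ξ₀ * h t j + pair (ξ t) (X j (γ t)) = 0
  adjoint : ∀ k, ∀ᵐ t ∂(volume.restrict (Icc (0 : ℝ) 1)),
    HasDerivAt (fun τ => ξ τ k)
      (-∑ j, ∑ i, fderiv ℝ (fun x => X j x i) (γ t) (Pi.single k 1) * h t j * ξ t i) t

/-- `θ_1, …, θ_m` is the frame of 1-forms dual to the frame `X_1, …, X_m` of vector fields. -/
def IsDualFrame {m : ℕ} (X θ : Fin m → Vec m → Vec m) : Prop :=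
  ∀ i j x, pair (θ i x) (X j x) = if i = j then 1 else 0

/-! The proof goes through the adjoint representation of `F`. Take `v_i = ⟨ξ(0), π_*Y_i(γ(0))⟩`; the
linear relations among the `π_*Y_i` pass to the `v_i`. For a homogeneous left invariant field `W` on
`F`, compare `⟨ξ, π_*W(γ)⟩` with `⟨v, Ad(κ) W(0)⟩`. By the adjoint equation the first has derivative
`∑ h_a ⟨ξ, π_*[Y_a, W](γ)⟩`, and since `Ad` differentiates to the bracket
(`LieGroupLaw.fderiv_Ad_apply`) the second has derivative `∑ h_a ⟨v, Ad(κ) [Y_a, W](0)⟩`. Both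
families solve the same triangular system, in which `W` is replaced by fields of higher degree, and
fields of degree above `s` vanish. Descending induction on the degree gives equality
(`pair_dual_eq_pair_Ad`); for `W = Y_{s_i}` the left side is `λ_i`.

It remains to identify `P_i^v(x)` with `⟨v, Ad(x) Y_i(0)⟩` (`IsHallBasis.extremalPoly_eq`). This is
where the special coordinates enter: `Y_j = ∂_j` wherever `x_1, …, x_{j-1}` vanish
(`IsHallBasis.hggField_eq_single`). Hence bringing `x_1`, then `x_2`, and so on to `0` moves along
integral lines of `Y_1`, `Y_2`, …. On the `j`-th leg each derivative of `Ad` on `W` produces `-[W,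
Y_j]`, so a terminating Taylor expansion contributes `(-x_j)^a / a!` and `a` brackets with `Y_j`.
Together the legs give the sum over multi-indices defining `P_i^v`, with the brackets in the right
order.

That `Y_j = ∂_j` there is combinatorial: a component of `Y_j` other than the `j`-th is zero or a
monomial containing a variable below `j` (`IsHallBasis.exists_index_lt`). -/

/-! ### Combinatorics of Hall bases -/

namespace IsHallBasis

variable {r s n : ℕ} {e : Fin n → FreeMagma (Fin r)}

/-- A bracket in a Hall basis is the bracket of two admissible basis elements. -/
lemma exists_factors (he : IsHallBasis r s n e) {l : Fin n} {t u : FreeMagma (Fin r)}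
    (h : e l = t * u) :
    ∃ i j, e i = t ∧ e j = u ∧ j < i ∧ ∀ h k, e i = e h * e k → k ≤ j :=
  ((he.bracket t u).1 ⟨l, h⟩).2

lemma lt_left (he : IsHallBasis r s n e) {l p q : Fin n} (h : e l = e p * e q) : q < p := by
  obtain ⟨i, j, hi, hj, hji, -⟩ := he.exists_factors h
  rwa [← he.injective hi, ← he.injective hj]

lemma le_of_left_eq (he : IsHallBasis r s n e) {l p q h k : Fin n} (hl : e l = e p * e q)
    (hp : e p = e h * e k) : k ≤ q := by
  obtain ⟨i, j, hi, hj, -, hk⟩ := he.exists_factors hl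
  obtain rfl := he.injective hi
  obtain rfl := he.injective hj
  exact hk _ _ hp

lemma left_lt (he : IsHallBasis r s n e) {l p q : Fin n} (h : e l = e p * e q) : p < l := by
  apply he.order
  have := (e q).length_pos
  rw [h]
  change _ < (e p).length + (e q).length
  omega

lemma right_lt (he : IsHallBasis r s n e) {l p q : Fin n} (h : e l = e p * e q) : q < l :=
  (he.lt_left h).trans (he.left_lt h)

lemma of_or_mul (he : IsHallBasis r s n e) (l : Fin n) :
    (∃ a, e l = FreeMagma.of a) ∨ ∃ p q, e l = e p * e q := by
  rcases hl : e l with a | ⟨t, u⟩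
  · exact Or.inl ⟨a, rfl⟩
  · obtain ⟨i, j, hi, hj, -⟩ := he.exists_factors (t := t) (u := u) hl
    exact Or.inr ⟨i, j, by rw [hi, hj]; rfl⟩

lemma length_le (he : IsHallBasis r s n e) (hs : 1 ≤ s) (l : Fin n) : (e l).length ≤ s := by
  rcases hl : e l with a | ⟨t, u⟩
  · exact hs
  · exact ((he.bracket t u).1 ⟨l, hl⟩).1

lemma index_of {l : Fin n} {a : Fin r} (h : e l = FreeMagma.of a) :
    hallIndex e l = 0 := by
  funext j
  simp [hallIndex, h, hallCount]

lemma index_mul (he : IsHallBasis r s n e) {l p q : Fin n} (h : e l = e p * e q) :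
    hallIndex e l = hallIndex e p + Pi.single q 1 := by
  funext j
  have : hallCount (e j) (e p * e q) = hallCount (e j) (e p) + if e q = e j then 1 else 0 := rfl
  simp only [hallIndex, h, this, Pi.add_apply, he.injective.eq_iff, Pi.single_apply]
  congr 1
  simp [eq_comm]

lemma head_mul {l p q : Fin n} (h : e l = e p * e q) :
    hallHead (e l) = hallHead (e p) := by
  rw [h]; rfl

lemma lt_of_index_pos (he : IsHallBasis r s n e) {l j : Fin n} (hj : 0 < hallIndex e l j) :
    j < l := by
  induction l using WellFoundedLT.induction with
  | _ l ih =>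
    rcases he.of_or_mul l with ⟨a, ha⟩ | ⟨p, q, hpq⟩
    · simp [index_of ha] at hj
    · rw [he.index_mul hpq, Pi.add_apply] at hj
      by_cases hq : j = q
      · exact hq ▸ he.right_lt hpq
      · exact (ih p (he.left_lt hpq) (by simpa [hq] using hj)).trans (he.left_lt hpq)

/-- Admissibility forces `ℓ_1 ≤ ℓ_2 ≤ ⋯ ≤ ℓ_h`, so the last letter is the largest one and can be
read off from `I(l)`. -/
lemma le_of_index_pos (he : IsHallBasis r s n e) {l p q j : Fin n} (h : e l = e p * e q)
    (hj : 0 < hallIndex e l j) : j ≤ q := by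
  induction l using WellFoundedLT.induction generalizing p q with
  | _ l ih =>
    rw [he.index_mul h, Pi.add_apply] at hj
    by_cases hq : j = q
    · exact hq.le
    have hj' : 0 < hallIndex e p j := by simpa [hq] using hj
    rcases he.of_or_mul p with ⟨a, ha⟩ | ⟨h', k, hk⟩
    · simp [index_of ha] at hj'
    · exact (ih p (he.left_lt h) hk hj').trans (he.le_of_left_eq h hk)

/-- If `I(l)` exceeds `I(i)` only at indices not below `i`, then `l = i`. -/
lemma eq_of_index (he : IsHallBasis r s n e) {l i : Fin n}
    (hh : hallHead (e l) = hallHead (e i)) (hle : hallIndex e i ≤ hallIndex e l)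
    (heq : ∀ j < i, hallIndex e l j = hallIndex e i j) : l = i := by
  induction l using WellFoundedLT.induction generalizing i with
  | _ l ih =>
    rcases he.of_or_mul l with ⟨a, ha⟩ | ⟨p, q, hpq⟩
    · rcases he.of_or_mul i with ⟨b, hb⟩ | ⟨p', q', hpq'⟩
      · have hab : a = b := by rw [ha, hb] at hh; exact hh
        exact he.injective (by rw [ha, hb, hab])
      · have := hle q'
        simp [index_of ha, he.index_mul hpq'] at this
    · have hl := he.index_mul hpq
      have hlq : 0 < hallIndex e l q := by simp [hl]
      have hoff : ∀ j, j ≠ q → hallIndex e l j = hallIndex e p j := fun j hj => by simp [hl, hj]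
      have hpl := he.left_lt hpq
      by_cases hc : hallIndex e i q ≤ hallIndex e p q
      -- Here `I(l)` exceeds `I(i)` at `q`, hence `i ≤ q`. Dropping the last letter of `l` keeps the
      -- hypotheses, so `p = i`, against `q < p`.
      · exfalso
        have hiq : i ≤ q := by
          by_contra hlt
          have := heq q (not_le.1 hlt)
          simp only [hl, Pi.add_apply, Pi.single_eq_same] at this
          omega
        have hpi : p = i := by
          refine ih p hpl ((head_mul hpq).symm.trans hh) (fun j => ?_) fun j hj => ?_
          · by_cases hj : j = q
            · exact hj ▸ hc
            · exact hoff j hj ▸ hle j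
          · rw [← hoff j (hj.trans_le hiq).ne, heq j hj]
        exact absurd (he.lt_left hpq) (by rw [hpi]; exact not_lt.2 hiq)
      -- Now `q` occurs in `i` as often as in `l`. Being the largest letter of both, it is the last
      -- letter of both and can be cancelled.
      · have hiq : 0 < hallIndex e i q := by omega
        have hiq' : hallIndex e i q = hallIndex e l q := by
          have := hle q
          simp only [hl, Pi.add_apply, Pi.single_eq_same] at this ⊢
          omega
        rcases he.of_or_mul i with ⟨b, hb⟩ | ⟨p', q', hpq'⟩
        · simp [index_of hb] at hiq
        have hi := he.index_mul hpq'
        have hqq : q' = q := by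
          refine le_antisymm ?_ (he.le_of_index_pos hpq' hiq)
          refine he.le_of_index_pos hpq (lt_of_lt_of_le ?_ (hle q'))
          simp [hi]
        subst hqq
        have hpp : p = p' := by
          refine ih p hpl ?_ (fun j => ?_) fun j hj => ?_
          · rw [← head_mul hpq, hh, head_mul hpq']
          · have := hle j
            simpa [hl, hi] using this
          · have := heq j (hj.trans (he.left_lt hpq'))
            simpa [hl, hi] using this
        exact he.injective (by rw [hpq, hpq', hpp])

/-- If `I(i) ≤ I(l)` with `l ≠ i` and equal heads, some index below `i` has excess in `I(l)`. -/
lemma exists_index_lt (he : IsHallBasis r s n e) {l i : Fin n}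
    (hh : hallHead (e l) = hallHead (e i)) (hle : hallIndex e i ≤ hallIndex e l)
    (hne : l ≠ i) : ∃ j < i, hallIndex e i j < hallIndex e l j := by
  by_contra! hcon
  exact hne (he.eq_of_index hh hle fun j hj => le_antisymm (hcon j hj) (hle j))

/-- If moreover `l < q ≤ i`, the index with excess may be taken below `q`. -/
lemma exists_index_lt_of_lt (he : IsHallBasis r s n e) {l q i : Fin n}
    (hh : hallHead (e l) = hallHead (e i)) (hle : hallIndex e i ≤ hallIndex e l)
    (hlq : l < q) (hqi : q ≤ i) : ∃ j < q, hallIndex e i j < hallIndex e l j := by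
  obtain ⟨j, -, hj⟩ := he.exists_index_lt hh hle (hlq.trans_le hqi).ne
  exact ⟨j, (he.lt_of_index_pos (by omega)).trans hlq, hj⟩

end IsHallBasis

/-! ### The Hall–Grayson–Grossman fields on coordinate subspaces -/

/-- The signed divided power `(-x)^β / β!`. -/
noncomputable def signedMonom {n : ℕ} (β : Fin n → ℕ) (x : Vec n) : ℝ :=
  ∏ j, (-x j) ^ β j / (β j).factorial

lemma signedMonom_eq {n : ℕ} (β : Fin n → ℕ) (x : Vec n) :
    signedMonom β x = (-1 : ℝ) ^ (∑ j, β j) / (multiFactorial β : ℝ) * monom β x := by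
  simp only [signedMonom, multiFactorial, monom, Finset.prod_div_distrib, Nat.cast_prod,
    ← Finset.prod_pow_eq_pow_sum, div_mul_eq_mul_div, ← Finset.prod_mul_distrib, ← mul_pow,
    neg_one_mul]

lemma signedMonom_zero {n : ℕ} (x : Vec n) : signedMonom 0 x = 1 := by simp [signedMonom]

lemma signedMonom_eq_zero {n : ℕ} {β : Fin n → ℕ} {x : Vec n} {j : Fin n} (hj : 0 < β j)
    (hx : x j = 0) : signedMonom β x = 0 :=
  Finset.prod_eq_zero (Finset.mem_univ j) (by simp [hx, hj.ne'])

lemma contDiff_signedMonom {n : ℕ} (β : Fin n → ℕ) : ContDiff ℝ ∞ (signedMonom β) := by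
  unfold signedMonom
  fun_prop

/-- The derivative of a signed divided power along a coordinate line. -/
lemma hasDerivAt_signedMonom {n : ℕ} (β : Fin n → ℕ) (x : Vec n) (q : Fin n) :
    HasDerivAt (fun t : ℝ => signedMonom β (x + t • Pi.single q 1))
      (-if 0 < β q then signedMonom (β - Pi.single q 1) x else 0) 0 := by
  have hsplit : ∀ (α : Fin n → ℕ) (y : Vec n), signedMonom α y =
      (-y q) ^ α q / (α q).factorial *
        ∏ j ∈ Finset.univ.erase q, (-y j) ^ α j / (α j).factorial := fun α y =>
    (Finset.mul_prod_erase _ _ (Finset.mem_univ q)).symm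
  have hrest : ∀ t : ℝ, signedMonom β (x + t • Pi.single q 1) =
      (-(x q + t)) ^ β q / (β q).factorial *
        ∏ j ∈ Finset.univ.erase q, (-x j) ^ β j / (β j).factorial := fun t => by
    rw [hsplit]
    congr 1
    · simp
    · refine Finset.prod_congr rfl fun j hj => ?_
      simp [Finset.ne_of_mem_erase hj]
  simp only [hrest]
  have h1 : HasDerivAt (fun t : ℝ => (-(x q + t)) ^ β q / ((β q).factorial : ℝ) *
      ∏ j ∈ Finset.univ.erase q, (-x j) ^ β j / ((β j).factorial : ℝ))
      (((β q : ℝ) * (-(x q + 0)) ^ (β q - 1) * (-1)) / ((β q).factorial : ℝ) *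
        ∏ j ∈ Finset.univ.erase q, (-x j) ^ β j / ((β j).factorial : ℝ)) 0 :=
    (((((hasDerivAt_id (0 : ℝ)).const_add (x q)).neg).pow (β q)).div_const _).mul_const _
  convert h1 using 1
  split_ifs with hq
  · rw [hsplit]
    have hp : ∏ j ∈ Finset.univ.erase q, (-x j) ^ (β - Pi.single q 1 : Fin n → ℕ) j /
        (((β - Pi.single q 1 : Fin n → ℕ) j).factorial : ℝ) =
        ∏ j ∈ Finset.univ.erase q, (-x j) ^ β j / ((β j).factorial : ℝ) := by
      refine Finset.prod_congr rfl fun j hj => ?_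
      simp [Finset.ne_of_mem_erase hj]
    rw [hp]
    obtain ⟨k, hk⟩ := Nat.exists_eq_succ_of_ne_zero hq.ne'
    have hf : ((k.factorial : ℕ) : ℝ) ≠ 0 := by positivity
    simp only [Pi.sub_apply, Pi.single_eq_same, hk, Nat.succ_eq_add_one, Nat.add_sub_cancel,
      Nat.factorial_succ, add_zero]
    push_cast
    field_simp
  · simp [Nat.eq_zero_of_not_pos hq]

lemma contDiff_ggField {r n : ℕ} (e : Fin n → FreeMagma (Fin r)) (a : Fin r) :
    ContDiff ℝ ∞ (ggField e a) := by
  refine contDiff_pi.2 fun l => ?_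
  unfold ggField
  split_ifs
  · simp only [← signedMonom_eq]
    exact contDiff_signedMonom _
  · exact contDiff_const

lemma ContDiff.lieBracket_infty {E : Type*} [NormedAddCommGroup E] [NormedSpace ℝ E]
    {V W : E → E} (hV : ContDiff ℝ ∞ V) (hW : ContDiff ℝ ∞ W) :
    ContDiff ℝ ∞ (VectorField.lieBracket ℝ V W) :=
  hV.lieBracket_vectorField hW (by simp)

lemma contDiff_bracketField {r n : ℕ} (e : Fin n → FreeMagma (Fin r)) (t : FreeMagma (Fin r)) :
    ContDiff ℝ ∞ (bracketField e t) := by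
  induction t with
  | ih1 a => exact contDiff_ggField e a
  | ih2 t u ht hu => exact ht.lieBracket_infty hu

lemma fderiv_apply_eq_of_line {E F : Type*} [NormedAddCommGroup E] [NormedSpace ℝ E]
    [NormedAddCommGroup F] [NormedSpace ℝ F] {f : E → F} {x u : E} {w : F}
    (hf : DifferentiableAt ℝ f x) (h : HasDerivAt (fun t : ℝ => f (x + t • u)) w 0) :
    fderiv ℝ f x u = w := by
  have hl : HasDerivAt (fun t : ℝ => x + t • u) u 0 := by
    simpa using ((hasDerivAt_id (0 : ℝ)).smul_const u).const_add x
  have hf' : HasFDerivAt f (fderiv ℝ f x) (x + (0 : ℝ) • u) := by simpa using hf.hasFDerivAt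
  exact (hf'.comp_hasDerivAt (0 : ℝ) hl).unique h

namespace IsHallBasis

variable {r s n : ℕ} {e : Fin n → FreeMagma (Fin r)}

lemma hggField_mul {i p q : Fin n} (h : e i = e p * e q) :
    hggField e i = VectorField.lieBracket ℝ (hggField e p) (hggField e q) := by
  unfold hggField
  rw [h]; rfl

open Classical in
/-- Where the coordinates below the last index of `Y_i` vanish, `Y_i` is, up to sign, the
derivative `∂^I(i)` of its head. -/
lemma hggField_apply (he : IsHallBasis r s n e) (i : Fin n) (x : Vec n)
    (hx : ∀ p q, e i = e p * e q → ∀ j < q, x j = 0) (l : Fin n) :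
    hggField e i x l = if hallHead (e l) = hallHead (e i) ∧ hallIndex e i ≤ hallIndex e l then
      signedMonom (hallIndex e l - hallIndex e i) x else 0 := by
  induction i using WellFoundedLT.induction generalizing x l with
  | _ i ih =>
  rcases he.of_or_mul i with ⟨a, ha⟩ | ⟨p, q, hpq⟩
  · have h0 := index_of ha
    have hhead : hallHead (e i) = a := by rw [ha]; rfl
    simp only [h0, hhead, zero_le, and_true, tsub_zero]
    have : hggField e i = ggField e a := by unfold hggField; rw [ha]; rfl
    rw [this]
    simp only [ggField, signedMonom_eq]
  have hpi := he.left_lt hpq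
  have hqi := he.right_lt hpq
  have hqp := he.lt_left hpq
  -- The last letter of `p` is at most `q`, so the formula for `Y_p` is available as soon as the
  -- coordinates below `q` vanish.
  have hp : ∀ y : Vec n, (∀ j < q, y j = 0) → ∀ l, hggField e p y l =
      if hallHead (e l) = hallHead (e p) ∧ hallIndex e p ≤ hallIndex e l then
        signedMonom (hallIndex e l - hallIndex e p) y else 0 := fun y hy l =>
    ih p hpi y (fun h k hk j hj => hy j (hj.trans_le (he.le_of_left_eq hpq hk))) l
  -- On the subspace where the coordinates below `q` vanish, `Y_q` is constant: every other
  -- component contains a vanishing variable.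
  have hq : ∀ y : Vec n, (∀ j < q, y j = 0) → hggField e q y = Pi.single q 1 := by
    intro y hy
    funext l
    rw [ih q hqi y (fun h k hk j hj => hy j (hj.trans (he.right_lt hk))) l]
    by_cases hl : l = q
    · subst hl
      simp [signedMonom_zero]
    rw [Pi.single_eq_of_ne hl]
    split_ifs with hc
    · obtain ⟨j, hj, hlt⟩ := he.exists_index_lt hc.1 hc.2 hl
      exact signedMonom_eq_zero (j := j) (by simpa using hlt) (hy j hj)
    · rfl
  have hxq : ∀ j < q, x j = 0 := hx p q hpq
  -- `Y_p` is tangent to that subspace, on which `Y_q` is constant.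
  have hdq : fderiv ℝ (hggField e q) x (hggField e p x) = 0 := by
    refine fderiv_apply_eq_of_line
      ((contDiff_bracketField e _).differentiable (by simp) x) ?_
    have hline : ∀ t : ℝ, hggField e q (x + t • hggField e p x) = Pi.single q 1 := by
      refine fun t => hq _ fun j hj => ?_
      have : hggField e p x j = 0 := by
        rw [hp x hxq]
        split_ifs with hc
        · obtain ⟨k, hk, hlt⟩ := he.exists_index_lt_of_lt hc.1 hc.2 hj hqp.le
          exact signedMonom_eq_zero (j := k) (by simpa using hlt) (hxq k hk)
        · rfl
      simp [hxq j hj, this]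
    simp only [hline]
    exact hasDerivAt_const _ _
  -- The `q`-th coordinate line also stays in the subspace, so the formula for `Y_p` may be
  -- differentiated along it.
  have hdp : fderiv ℝ (hggField e p) x (Pi.single q 1) l =
      if hallHead (e l) = hallHead (e p) ∧ hallIndex e p ≤ hallIndex e l then
        -if 0 < (hallIndex e l - hallIndex e p) q then
          signedMonom (hallIndex e l - hallIndex e p - Pi.single q 1) x else 0 else 0 := by
    have hd := (contDiff_bracketField e (e p)).differentiable (by simp) x
    have : fderiv ℝ (hggField e p) x (Pi.single q 1) l =
        fderiv ℝ (fun y => hggField e p y l) x (Pi.single q 1) := by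
      exact congrFun (congrArg DFunLike.coe
        (fderiv_apply (Φ := hggField e p) hd l).symm) (Pi.single q 1)
    rw [this]
    refine fderiv_apply_eq_of_line (differentiableAt_pi.1 hd l) ?_
    have hline : ∀ t : ℝ, hggField e p (x + t • Pi.single q 1) l =
        if hallHead (e l) = hallHead (e p) ∧ hallIndex e p ≤ hallIndex e l then
        signedMonom (hallIndex e l - hallIndex e p) (x + t • Pi.single q 1) else 0 := by
      refine fun t => hp _ (fun j hj => ?_) l
      simp [hxq j hj, hj.ne]
    simp only [hline]
    by_cases hc : hallHead (e l) = hallHead (e p) ∧ hallIndex e p ≤ hallIndex e l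
    · simpa only [if_pos hc] using hasDerivAt_signedMonom (hallIndex e l - hallIndex e p) x q
    · simp only [if_neg hc]
      exact hasDerivAt_const _ _
  -- Only `-∂_q Y_p` survives in the bracket; its sign cancels the one from differentiating a signed
  -- divided power.
  have hval : hggField e i x l = -fderiv ℝ (hggField e p) x (Pi.single q 1) l := by
    rw [hggField_mul hpq, VectorField.lieBracket, hdq, hq x hxq]
    simp
  rw [hval, hdp, head_mul hpq, he.index_mul hpq, tsub_add_eq_tsub_tsub]
  have hiff : hallIndex e p + Pi.single q 1 ≤ hallIndex e l ↔
      hallIndex e p ≤ hallIndex e l ∧ 0 < (hallIndex e l - hallIndex e p) q := by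
    constructor
    · intro h
      refine ⟨le_trans le_self_add h, ?_⟩
      have := h q
      simp only [Pi.add_apply, Pi.single_eq_same, Pi.sub_apply] at this ⊢
      omega
    · rintro ⟨h, h0⟩ j
      by_cases hj : j = q
      · subst hj
        simp only [Pi.add_apply, Pi.single_eq_same, Pi.sub_apply] at h0 ⊢
        omega
      · simpa [hj] using h j
  rw [hiff]
  split_ifs <;> simp_all

/-- `Y_i = ∂_i` where the coordinates below `i` vanish. -/
lemma hggField_eq_single (he : IsHallBasis r s n e) {i : Fin n} {x : Vec n}
    (hx : ∀ j < i, x j = 0) : hggField e i x = Pi.single i 1 := by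
  funext l
  rw [he.hggField_apply i x (fun p q h j hj => hx j (hj.trans (he.right_lt h))) l]
  by_cases hl : l = i
  · subst hl
    simp [signedMonom_zero]
  rw [Pi.single_eq_of_ne hl]
  split_ifs with hc
  · obtain ⟨j, hj, hlt⟩ := he.exists_index_lt hc.1 hc.2 hl
    exact signedMonom_eq_zero (j := j) (by simpa using hlt) (hx j hj)
  · rfl

end IsHallBasis

/-! ### Related vector fields -/

section Related

lemma minSmoothness_two_le_infty : minSmoothness ℝ 2 ≤ (∞ : WithTop ℕ∞) := by
  rw [minSmoothness_of_isRCLikeNormedField]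
  exact WithTop.coe_le_coe.2 (le_top : (2 : ℕ∞) ≤ ⊤)

variable {E F H : Type*} [NormedAddCommGroup E] [NormedSpace ℝ E] [NormedAddCommGroup F]
  [NormedSpace ℝ F] [NormedAddCommGroup H] [NormedSpace ℝ H]

/-- Brackets of `φ`-related vector fields are `φ`-related. -/
lemma lieBracket_related {φ : E → F} (hφ : ContDiff ℝ ∞ φ) {X Y : E → E} {X' Y' : F → F}
    (hX : ContDiff ℝ ∞ X) (hY : ContDiff ℝ ∞ Y) (hX' : ContDiff ℝ ∞ X') (hY' : ContDiff ℝ ∞ Y')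
    (h : ∀ x, X' (φ x) = fderiv ℝ φ x (X x)) (h' : ∀ x, Y' (φ x) = fderiv ℝ φ x (Y x)) (x : E) :
    VectorField.lieBracket ℝ X' Y' (φ x) = fderiv ℝ φ x (VectorField.lieBracket ℝ X Y x) := by
  have key : ∀ Z' : F → F, ContDiff ℝ ∞ Z' → ∀ w,
      fderiv ℝ (fun y => Z' (φ y)) x w = fderiv ℝ Z' (φ x) (fderiv ℝ φ x w) := fun Z' hZ' w => by
    rw [fderiv_fun_comp x (hZ'.differentiable (by simp) _) (hφ.differentiable (by simp) _)]
    rfl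
  rw [VectorField.fderiv_apply_lieBracket (n := ∞) hφ.contDiffAt minSmoothness_two_le_infty
    (hY.differentiable (by simp) x) (hX.differentiable (by simp) x)]
  simp only [← h, ← h', key X' hX', key Y' hY']
  rfl

lemma fderiv_prodMk_right {f : E × F → H} (hf : ContDiff ℝ ∞ f) (x : E) (y w : F) :
    fderiv ℝ (fun z => f (x, z)) y w = fderiv ℝ f (x, y) (0, w) := by
  have h : HasFDerivAt (fun z => f (x, z))
      ((fderiv ℝ f (x, y)).comp ((0 : F →L[ℝ] E).prod (ContinuousLinearMap.id ℝ F))) y :=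
    (hf.differentiable (by simp) (x, y)).hasFDerivAt.comp y
      ((hasFDerivAt_const x y).prodMk (hasFDerivAt_id y))
  rw [h.fderiv]
  rfl

lemma fderiv_prodMk_left {f : E × F → H} (hf : ContDiff ℝ ∞ f) (x w : E) (y : F) :
    fderiv ℝ (fun z => f (z, y)) x w = fderiv ℝ f (x, y) (w, 0) := by
  have h : HasFDerivAt (fun z => f (z, y))
      ((fderiv ℝ f (x, y)).comp ((ContinuousLinearMap.id ℝ E).prod (0 : E →L[ℝ] F))) x :=
    (hf.differentiable (by simp) (x, y)).hasFDerivAt.comp x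
      ((hasFDerivAt_id x).prodMk (hasFDerivAt_const y x))
  rw [h.fderiv]
  rfl

/-- The mixed second derivatives of a smooth function of two variables agree. -/
lemma fderiv_fderiv_prodMk_comm {f : E × F → H} (hf : ContDiff ℝ ∞ f) (x u : E) (y w : F) :
    fderiv ℝ (fun b => fderiv ℝ (fun a => f (a, b)) x u) y w =
      fderiv ℝ (fun a => fderiv ℝ (fun b => f (a, b)) y w) x u := by
  have hd : ContDiff ℝ ∞ (fderiv ℝ f) := hf.fderiv_right (by simp)
  simp only [fderiv_prodMk_left hf, fderiv_prodMk_right hf]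
  rw [fderiv_prodMk_right (f := fun p => fderiv ℝ f p (u, 0)) (hd.clm_apply contDiff_const),
    fderiv_prodMk_left (f := fun p => fderiv ℝ f p (0, w)) (hd.clm_apply contDiff_const),
    fderiv_clm_apply (hd.differentiable (by simp) _) (differentiableAt_const _),
    fderiv_clm_apply (hd.differentiable (by simp) _) (differentiableAt_const _)]
  simpa using (hf.contDiffAt.isSymmSndFDerivAt (x := (x, y))
    minSmoothness_two_le_infty).eq (0, w) (u, 0)

end Related

/-! ### Left invariant fields and the adjoint representation -/

namespace LieGroupLaw

variable {n : ℕ} (G : LieGroupLaw n)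

lemma contDiff_mul_left (x : Vec n) : ContDiff ℝ ∞ (G.mul x) :=
  G.contDiff_mul.comp (contDiff_const.prodMk contDiff_id)

lemma contDiff_mul_right (y : Vec n) : ContDiff ℝ ∞ fun x => G.mul x y :=
  G.contDiff_mul.comp (contDiff_id.prodMk contDiff_const)

lemma mul_eq_zero_comm {x y : Vec n} (h : G.mul x y = 0) : G.mul y x = 0 := by
  have hx : x = G.inv y := by
    have hz : G.mul (G.inv (G.inv y)) (G.inv y) = 0 := G.inv_mul _
    have hy : G.mul y (G.inv y) = 0 := by
      calc G.mul y (G.inv y)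
          = G.mul (G.mul (G.inv (G.inv y)) (G.inv y)) (G.mul y (G.inv y)) := by
            rw [hz, G.zero_mul]
        _ = G.mul (G.inv (G.inv y)) (G.mul (G.mul (G.inv y) y) (G.inv y)) := by
            simp only [G.mul_assoc]
        _ = 0 := by rw [G.inv_mul, G.zero_mul, hz]
    calc x = G.mul x (G.mul y (G.inv y)) := by rw [hy, G.mul_zero]
      _ = G.inv y := by rw [← G.mul_assoc, h, G.zero_mul]
  subst hx
  calc G.mul y (G.inv y)
      = G.mul (G.mul (G.inv (G.inv y)) (G.inv y)) (G.mul y (G.inv y)) := by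
        rw [G.inv_mul, G.zero_mul]
    _ = G.mul (G.inv (G.inv y)) (G.mul (G.mul (G.inv y) y) (G.inv y)) := by
        simp only [G.mul_assoc]
    _ = 0 := by rw [G.inv_mul, G.zero_mul, G.inv_mul]

lemma mul_inv (x : Vec n) : G.mul x (G.inv x) = 0 := G.mul_eq_zero_comm (G.inv_mul x)

lemma inv_mul_cancel_left (x y : Vec n) : G.mul (G.inv x) (G.mul x y) = y := by
  rw [← G.mul_assoc, G.inv_mul, G.zero_mul]

lemma inv_zero : G.inv 0 = 0 := by rw [← G.mul_zero (G.inv 0), G.inv_mul]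

lemma inv_mul_rev (x y : Vec n) : G.inv (G.mul x y) = G.mul (G.inv y) (G.inv x) := by
  have h : G.mul (G.mul x y) (G.mul (G.inv y) (G.inv x)) = 0 := by
    rw [G.mul_assoc, ← G.mul_assoc y, G.mul_inv, G.zero_mul, G.mul_inv]
  rw [← G.mul_zero (G.inv (G.mul x y)), ← h, G.inv_mul_cancel_left]

/-- The left invariant vector field with value `w` at the identity. -/
noncomputable def leftField (w : Vec n) : Vec n → Vec n := fun x => fderiv ℝ (G.mul x) 0 w

lemma leftField_zero (w : Vec n) : G.leftField w 0 = w := by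
  have : G.mul 0 = id := funext G.zero_mul
  simp [leftField, this]

lemma contDiff_leftField (w : Vec n) : ContDiff ℝ ∞ (G.leftField w) := by
  have h : G.leftField w = fun x => fderiv ℝ (fun p : Vec n × Vec n => G.mul p.1 p.2) (x, 0)
      (0, w) := funext fun x => fderiv_prodMk_right G.contDiff_mul x 0 w
  rw [h]
  exact ((G.contDiff_mul.fderiv_right (m := ∞) (by simp)).comp
    (contDiff_id.prodMk contDiff_const)).clm_apply contDiff_const

lemma leftField_mem (w : Vec n) : G.leftField w ∈ G.lieAlg := by
  intro x y
  have h : G.mul (G.mul x y) = G.mul x ∘ G.mul y := funext fun z => G.mul_assoc x y z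
  simp only [leftField, h]
  rw [fderiv_comp _ ((G.contDiff_mul_left x).differentiable (by simp) _)
    ((G.contDiff_mul_left y).differentiable (by simp) _), G.mul_zero]
  rfl

variable {G}

lemma eq_leftField {X : Vec n → Vec n} (hX : X ∈ G.lieAlg) : X = G.leftField (X 0) := by
  funext x
  have h := hX x 0
  rwa [G.mul_zero] at h

lemma contDiff_of_mem {X : Vec n → Vec n} (hX : X ∈ G.lieAlg) : ContDiff ℝ ∞ X :=
  eq_leftField hX ▸ G.contDiff_leftField _

lemma eq_of_apply_zero {X Y : Vec n → Vec n} (hX : X ∈ G.lieAlg) (hY : Y ∈ G.lieAlg)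
    (h : X 0 = Y 0) : X = Y := by
  rw [eq_leftField hX, eq_leftField hY, h]

lemma lieBracket_mem {X Y : Vec n → Vec n} (hX : X ∈ G.lieAlg) (hY : Y ∈ G.lieAlg) :
    VectorField.lieBracket ℝ X Y ∈ G.lieAlg := fun x y =>
  lieBracket_related (G.contDiff_mul_left x) (contDiff_of_mem hX) (contDiff_of_mem hY)
    (contDiff_of_mem hX) (contDiff_of_mem hY) (hX x) (hY x) y

variable (G)

/-- The adjoint representation, on the tangent space at the identity. -/
noncomputable def Ad (x : Vec n) : Vec n →L[ℝ] Vec n :=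
  fderiv ℝ (fun y => G.mul (G.mul x y) (G.inv x)) 0

lemma contDiff_conj : ContDiff ℝ ∞ fun p : Vec n × Vec n =>
    G.mul (G.mul p.1 p.2) (G.inv p.1) :=
  G.contDiff_mul.comp (G.contDiff_mul.prodMk (G.contDiff_inv.comp contDiff_fst))

lemma contDiff_Ad_apply (w : Vec n) : ContDiff ℝ ∞ fun x => G.Ad x w := by
  have h : (fun x => G.Ad x w) = fun x => fderiv ℝ (fun p : Vec n × Vec n =>
      G.mul (G.mul p.1 p.2) (G.inv p.1)) (x, 0) (0, w) :=
    funext fun x => fderiv_prodMk_right G.contDiff_conj x 0 w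
  rw [h]
  exact ((G.contDiff_conj.fderiv_right (m := ∞) (by simp)).comp
    (contDiff_id.prodMk contDiff_const)).clm_apply contDiff_const

lemma Ad_zero : G.Ad 0 = ContinuousLinearMap.id ℝ _ := by
  have : (fun y => G.mul (G.mul 0 y) (G.inv 0)) = id :=
    funext fun y => by rw [G.zero_mul, G.inv_zero, G.mul_zero]; rfl
  rw [Ad, this, fderiv_id]

lemma Ad_mul_apply (x y w : Vec n) : G.Ad (G.mul x y) w = G.Ad x (G.Ad y w) := by
  have hc : ∀ x, Differentiable ℝ fun y => G.mul (G.mul x y) (G.inv x) := fun x =>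
    (G.contDiff_conj.comp (contDiff_const.prodMk contDiff_id)).differentiable (by simp)
  have h : (fun z => G.mul (G.mul (G.mul x y) z) (G.inv (G.mul x y))) =
      (fun z => G.mul (G.mul x z) (G.inv x)) ∘ fun z => G.mul (G.mul y z) (G.inv y) := by
    funext z
    simp only [Function.comp_apply, G.inv_mul_rev, G.mul_assoc]
  have h0 : G.mul (G.mul y 0) (G.inv y) = 0 := by rw [G.mul_zero, G.mul_inv]
  rw [Ad, h, fderiv_comp _ (hc x _) (hc y _), h0]
  rfl

/-- The derivative of `Ad` at the identity is the bracket. -/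
lemma fderiv_Ad_zero (u w : Vec n) : fderiv ℝ (fun x => G.Ad x w) 0 u =
    VectorField.lieBracket ℝ (G.leftField u) (G.leftField w) 0 := by
  -- `B x` is the differential at the identity of right translation by `x`. Left translation is
  -- conjugation followed by right translation, so the left invariant field of `w` is `B x (Ad x
  -- w)`. In the product rule at `0`, the term from `B` is the derivative along `w` of the left
  -- invariant field of `u`, by symmetry of mixed derivatives.
  let B : Vec n → Vec n →L[ℝ] Vec n := fun x => fderiv ℝ (fun z => G.mul z x) 0
  have hBd : Differentiable ℝ B := by
    have h : B = fun x => (fderiv ℝ (fun p : Vec n × Vec n => G.mul p.1 p.2) (0, x)).comp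
        (ContinuousLinearMap.inl ℝ (Vec n) (Vec n)) := by
      funext x
      ext1 w
      exact fderiv_prodMk_left G.contDiff_mul 0 w x
    rw [h]
    exact ((((G.contDiff_mul.fderiv_right (m := ∞) (by simp)).comp
      (contDiff_const.prodMk contDiff_id)).clm_comp contDiff_const).differentiable (by simp))
  have hB0 : B 0 = ContinuousLinearMap.id ℝ _ := by
    have : (fun z => G.mul z 0) = id := funext G.mul_zero
    simp only [B, this, fderiv_id]
  have hBA : ∀ x, G.leftField w x = B x (G.Ad x w) := by
    intro x
    have h : G.mul x = (fun z => G.mul z x) ∘ fun y => G.mul (G.mul x y) (G.inv x) := by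
      funext y
      simp only [Function.comp_apply]
      rw [G.mul_assoc, G.inv_mul, G.mul_zero]
    have h0 : G.mul (G.mul x 0) (G.inv x) = 0 := by rw [G.mul_zero, G.mul_inv]
    have hc : Differentiable ℝ fun y => G.mul (G.mul x y) (G.inv x) :=
      (G.contDiff_conj.comp (contDiff_const.prodMk contDiff_id)).differentiable (by simp)
    rw [leftField, h, fderiv_comp _ ((G.contDiff_mul_right x).differentiable (by simp) _) (hc _),
      h0]
    rfl
  have hBw : ∀ v : Vec n, fderiv ℝ (fun x => B x v) 0 u = fderiv ℝ B 0 u v := fun v => by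
    rw [fderiv_clm_apply (hBd 0) (differentiableAt_const _)]
    simp
  have hsymm : fderiv ℝ B 0 u w = fderiv ℝ (G.leftField u) 0 w := by
    rw [← hBw]
    exact fderiv_fderiv_prodMk_comm G.contDiff_mul 0 w 0 u
  have hL : fderiv ℝ (G.leftField w) 0 u =
      fderiv ℝ (fun x => G.Ad x w) 0 u + fderiv ℝ B 0 u w := by
    have : G.leftField w = fun x => B x (G.Ad x w) := funext hBA
    rw [this, fderiv_clm_apply (hBd 0) ((G.contDiff_Ad_apply w).differentiable (by simp) 0), hB0,
      G.Ad_zero]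
    simp
  rw [VectorField.lieBracket, G.leftField_zero, G.leftField_zero, hL, hsymm]
  abel

variable {G}

/-- `Ad` along a left invariant field `X` has the derivative `Ad ∘ ad X`. -/
lemma fderiv_Ad_apply {X W : Vec n → Vec n} (hX : X ∈ G.lieAlg) (hW : W ∈ G.lieAlg)
    (x : Vec n) : fderiv ℝ (fun x => G.Ad x (W 0)) x (X x) =
      G.Ad x (VectorField.lieBracket ℝ X W 0) := by
  have hd := (G.contDiff_Ad_apply (W 0)).differentiable (by simp)
  -- Left invariance of `X` and multiplicativity of `Ad` move the derivative from `x` to the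
  -- identity.
  have h1 : fderiv ℝ (fun y => G.Ad (G.mul x y) (W 0)) 0 (X 0) =
      fderiv ℝ (fun x => G.Ad x (W 0)) x (X x) := by
    have h := fderiv_fun_comp (f := G.mul x) (g := fun x => G.Ad x (W 0)) 0 (hd _)
      ((G.contDiff_mul_left x).differentiable (by simp) _)
    rw [h, G.mul_zero, eq_leftField hX, G.leftField_zero]
    rfl
  have h2 : (fun y => G.Ad (G.mul x y) (W 0)) = fun y => G.Ad x (G.Ad y (W 0)) :=
    funext fun y => G.Ad_mul_apply x y _
  have h3 : fderiv ℝ (fun y => G.Ad x (G.Ad y (W 0))) 0 (X 0) =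
      G.Ad x (fderiv ℝ (fun y => G.Ad y (W 0)) 0 (X 0)) := by
    have h : HasFDerivAt (fun y => G.Ad x (G.Ad y (W 0)))
        ((G.Ad x).comp (fderiv ℝ (fun y => G.Ad y (W 0)) 0)) 0 :=
      (G.Ad x).hasFDerivAt.comp 0 (hd 0).hasFDerivAt
    rw [h.fderiv]
    rfl
  rw [← h1, h2, h3, fderiv_Ad_zero, ← eq_leftField hX, ← eq_leftField hW]

end LieGroupLaw

/-! ### The differential of a homomorphism -/

section Push

variable {n m : ℕ} {F : LieGroupLaw n} {G : LieGroupLaw m} {π : Vec n → Vec m}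

lemma IsLieGroupHom.map_zero (hπ : IsLieGroupHom F G π) : π 0 = 0 := by
  have h : G.mul (π 0) (π 0) = π 0 := by rw [← hπ.map_mul, F.mul_zero]
  rw [← G.inv_mul_cancel_left (π 0) (π 0), h, G.inv_mul]

lemma pushLie_mem (Y : Vec n → Vec n) : pushLie G π Y ∈ G.lieAlg := G.leftField_mem _

lemma pushLie_zero (Y : Vec n → Vec n) : pushLie G π Y 0 = fderiv ℝ π 0 (Y 0) :=
  G.leftField_zero _

/-- Differentiating `π(xy) = π(x)π(y)` in `y` at `0` spreads the relation between `Y` and its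
projection from the identity to all of `F`. -/
lemma IsLieGroupHom.pushLie_apply (hπ : IsLieGroupHom F G π) {Y : Vec n → Vec n}
    (hY : Y ∈ F.lieAlg) (x : Vec n) : pushLie G π Y (π x) = fderiv ℝ π x (Y x) := by
  have hd := hπ.contDiff.differentiable (by simp)
  have h : π ∘ F.mul x = G.mul (π x) ∘ π := funext fun y => hπ.map_mul x y
  have h1 := fderiv_comp (f := F.mul x) (g := π) 0 (hd _)
    ((F.contDiff_mul_left x).differentiable (by simp) _)
  have h2 := fderiv_comp (f := π) (g := G.mul (π x)) 0
    ((G.contDiff_mul_left (π x)).differentiable (by simp) _) (hd _)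
  rw [h, h2, hπ.map_zero, F.mul_zero] at h1
  rw [LieGroupLaw.eq_leftField hY]
  have := congrArg (fun T : Vec n →L[ℝ] Vec m => T (Y 0)) h1
  simpa [pushLie, LieGroupLaw.leftField, F.leftField_zero,
    show F.mul 0 = id from funext F.zero_mul] using this

/-- Both sides are left invariant, so it is enough to compare them at the identity, where
relatedness of brackets applies. -/
lemma IsLieGroupHom.pushLie_lieBracket (hπ : IsLieGroupHom F G π) {X Y : Vec n → Vec n}
    (hX : X ∈ F.lieAlg) (hY : Y ∈ F.lieAlg) :
    pushLie G π (VectorField.lieBracket ℝ X Y) =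
      VectorField.lieBracket ℝ (pushLie G π X) (pushLie G π Y) := by
  refine LieGroupLaw.eq_of_apply_zero (pushLie_mem _)
    (LieGroupLaw.lieBracket_mem (pushLie_mem X) (pushLie_mem Y)) ?_
  have := lieBracket_related hπ.contDiff (LieGroupLaw.contDiff_of_mem hX)
    (LieGroupLaw.contDiff_of_mem hY) (LieGroupLaw.contDiff_of_mem (pushLie_mem (G := G) X))
    (LieGroupLaw.contDiff_of_mem (pushLie_mem (G := G) Y)) (hπ.pushLie_apply hX)
    (hπ.pushLie_apply hY) 0
  rw [hπ.map_zero] at this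
  rw [this, pushLie_zero]

end Push

/-! ### Homogeneous vector fields -/

/-- The anisotropic dilation with weights `d`. -/
noncomputable def dilation {n : ℕ} (d : Fin n → ℕ) (c : ℝ) : Vec n →L[ℝ] Vec n :=
  ContinuousLinearMap.pi fun j => c ^ d j • ContinuousLinearMap.proj j

/-- `W` is homogeneous of degree `k` as a derivation, for the dilations with weights `d`. -/
def IsHomogField {n : ℕ} (d : Fin n → ℕ) (k : ℕ) (W : Vec n → Vec n) : Prop :=
  ∀ c x, c ^ k • W (dilation d c x) = dilation d c (W x)

namespace IsHomogField

variable {n : ℕ} {d : Fin n → ℕ} {k k' : ℕ} {V W : Vec n → Vec n}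

lemma fderiv_apply (hW : IsHomogField d k W) (hd : ContDiff ℝ ∞ W) (c : ℝ) (x u : Vec n) :
    c ^ k • fderiv ℝ W (dilation d c x) (dilation d c u) = dilation d c (fderiv ℝ W x u) := by
  have hW' := hd.differentiable (by simp)
  have h1 : HasFDerivAt (fun y => c ^ k • W (dilation d c y))
      (c ^ k • (fderiv ℝ W (dilation d c x)).comp (dilation d c)) x :=
    ((hW' _).hasFDerivAt.comp x (dilation d c).hasFDerivAt).const_smul (c ^ k)
  have h2 : HasFDerivAt (fun y => dilation d c (W y)) ((dilation d c).comp (fderiv ℝ W x)) x :=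
    (dilation d c).hasFDerivAt.comp x (hW' x).hasFDerivAt
  rw [show (fun y => c ^ k • W (dilation d c y)) = fun y => dilation d c (W y) from
    funext (hW c)] at h1
  exact congrArg (fun T : Vec n →L[ℝ] Vec n => T u) (h1.unique h2)

lemma lieBracket (hV : IsHomogField d k V) (hW : IsHomogField d k' W) (hVd : ContDiff ℝ ∞ V)
    (hWd : ContDiff ℝ ∞ W) : IsHomogField d (k + k') (VectorField.lieBracket ℝ V W) := by
  intro c x
  rw [VectorField.lieBracket, VectorField.lieBracket, map_sub, ← hW.fderiv_apply hWd,
    ← hV.fderiv_apply hVd, ← hV, ← hW, map_smul, map_smul, smul_smul, smul_smul, smul_sub,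
    pow_add, mul_comm (c ^ k')]

/-- The origin is fixed by dilations, so with `c = 2` the component `w_l` of `W 0` satisfies `2^k
w_l = 2^(d l) w_l`. -/
lemma apply_zero (hW : IsHomogField d k W) (hk : ∀ l, d l < k) : W 0 = 0 := by
  funext l
  have h := congrFun (hW 2 0) l
  rw [map_zero] at h
  simp only [Pi.smul_apply, smul_eq_mul, dilation, ContinuousLinearMap.coe_pi',
    smul_apply, ContinuousLinearMap.proj_apply] at h
  have hlt : (2 : ℝ) ^ d l < 2 ^ k := pow_lt_pow_right₀ (by norm_num) (hk l)
  rw [← sub_eq_zero, ← sub_mul, mul_eq_zero] at h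
  exact h.resolve_left (sub_pos.2 hlt).ne'

end IsHomogField

/-- Each letter contributes its degree and the head contributes `1`. Thus `x^I(l)` has weight one
less than `x_l`, which makes the generators homogeneous of degree `1`. -/
lemma IsHallBasis.length_eq {r s n : ℕ} {e : Fin n → FreeMagma (Fin r)}
    (he : IsHallBasis r s n e) (l : Fin n) :
    (∑ j, hallIndex e l j * (e j).length) + 1 = (e l).length := by
  induction l using WellFoundedLT.induction with
  | _ l ih =>
    rcases he.of_or_mul l with ⟨a, ha⟩ | ⟨p, q, hpq⟩
    · simp [IsHallBasis.index_of ha, ha]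
    · have hl : (e l).length = (e p).length + (e q).length := by rw [hpq]; rfl
      rw [hl, ← ih p (he.left_lt hpq), he.index_mul hpq]
      simp only [Pi.add_apply, add_mul, Finset.sum_add_distrib, Pi.single_apply, ite_mul, one_mul,
        zero_mul, Finset.sum_ite_eq', Finset.mem_univ, if_true]
      omega

lemma IsHallBasis.isHomogField_ggField {r s n : ℕ} {e : Fin n → FreeMagma (Fin r)}
    (he : IsHallBasis r s n e) (a : Fin r) :
    IsHomogField (fun j => (e j).length) 1 (ggField e a) := by
  intro c x
  funext l
  simp only [dilation, Pi.smul_apply, smul_eq_mul, ContinuousLinearMap.coe_pi',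
    smul_apply, ContinuousLinearMap.proj_apply, ggField, ← signedMonom_eq]
  split_ifs
  · have h : signedMonom (hallIndex e l) (fun j => c ^ (e j).length * x j) =
        c ^ (∑ j, hallIndex e l j * (e j).length) * signedMonom (hallIndex e l) x := by
      rw [← Finset.prod_pow_eq_pow_sum]
      simp only [signedMonom]
      rw [← Finset.prod_mul_distrib]
      refine Finset.prod_congr rfl fun j _ => ?_
      rw [← mul_neg, mul_pow, ← pow_mul, mul_comm (e j).length, mul_div_assoc]
    rw [← he.length_eq l, h]
    ring
  · simp

lemma IsHallBasis.isHomogField_bracketField {r s n : ℕ} {e : Fin n → FreeMagma (Fin r)}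
    (he : IsHallBasis r s n e) (t : FreeMagma (Fin r)) :
    IsHomogField (fun j => (e j).length) t.length (bracketField e t) := by
  induction t with
  | ih1 a => exact he.isHomogField_ggField a
  | ih2 t u ht hu =>
    exact ht.lieBracket hu (contDiff_bracketField e t) (contDiff_bracketField e u)

/-! ### Flowing to the origin along coordinate lines -/

/-- Taylor's formula for a terminating sequence of successive derivatives. -/
lemma eq_sum_of_hasDerivAt_neg {E : Type*} [NormedAddCommGroup E] [NormedSpace ℝ E] (N : ℕ)
    (f : ℕ → ℝ → E) (hf : ∀ k t, HasDerivAt (f k) (-f (k + 1) t) t) (hN : ∀ t, f N t = 0)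
    (t : ℝ) : f 0 t = ∑ k ∈ Finset.range N, ((-t) ^ k / (k.factorial : ℝ)) • f k 0 := by
  induction N generalizing f t with
  | zero => simpa using hN t
  | succ N ih =>
    have h1 := ih (fun k => f (k + 1)) (fun k t => hf (k + 1) t) hN
    -- The Taylor polynomial of `f 0`. By the induction hypothesis for the shifted sequence it has
    -- the same derivative as `f 0`, and it agrees with `f 0` at `0`.
    let g : ℝ → E := fun t =>
      ∑ k ∈ Finset.range (N + 1), ((-t) ^ k / (k.factorial : ℝ)) • f k 0
    have hg : ∀ t, HasDerivAt g (-f 1 t) t := by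
      intro t
      have hpow : ∀ k : ℕ, HasDerivAt (fun t : ℝ => (-t) ^ (k + 1) / ((k + 1).factorial : ℝ))
          (-((-t) ^ k / (k.factorial : ℝ))) t := by
        intro k
        have h := (((hasDerivAt_id t).neg).pow (k + 1)).div_const ((k + 1).factorial : ℝ)
        convert! h using 1
        rw [Nat.factorial_succ]
        have : (k.factorial : ℝ) ≠ 0 := by positivity
        simp only [Nat.add_sub_cancel]
        push_cast
        simp only [Pi.neg_apply, id]
        field_simp
      have hgs : g = fun t => (∑ k ∈ Finset.range N,
          ((-t) ^ (k + 1) / ((k + 1).factorial : ℝ)) • f (k + 1) 0) + f 0 0 := by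
        funext t
        simp only [g, Finset.sum_range_succ']
        simp
      rw [hgs, h1 t, ← Finset.sum_neg_distrib]
      refine HasDerivAt.add_const _ ?_
      refine HasDerivAt.fun_sum fun k _ => ?_
      simpa using (hpow k).smul_const (f (k + 1) 0)
    have hd : ∀ t, HasDerivAt (f 0 - g) 0 t := fun t => by
      simpa using (hf 0 t).sub (hg t)
    have hc := is_const_of_deriv_eq_zero (fun t => (hd t).differentiableAt)
      (fun t => (hd t).deriv) t 0
    have hg0 : g 0 = f 0 0 := by simp [g, Finset.sum_range_succ']
    simpa [hg0, sub_eq_zero] using hc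

/-- Iterating the expansions `Φ_j W = ∑ k, c_j(k) Φ_{j+1} (T_j^k W)`. -/
lemma sum_foldl_iterate {E A : Type*} [AddCommGroup E] [Module ℝ E] (N : ℕ) {P : A → Prop}
    {n : ℕ} (T : Fin n → A → A) (c : Fin n → ℕ → ℝ) (Φ : Fin (n + 1) → A → E)
    (hP : ∀ j W, P W → P (T j W))
    (h : ∀ j W, P W → Φ j.castSucc W =
      ∑ k ∈ Finset.range N, c j k • Φ j.succ ((T j)^[k] W)) (W : A) (hW : P W) :
    Φ 0 W = ∑ α : Fin n → Fin N, (∏ j, c j (α j)) •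
      Φ (Fin.last n) ((List.finRange n).foldl (fun V j => (T j)^[(α j : ℕ)] V) W) := by
  induction n generalizing W with
  | zero => simp
  | succ n ih =>
    have hit : ∀ k, P ((T 0)^[k] W) := fun k => by
      induction k with
      | zero => exact hW
      | succ k ihk => rw [Function.iterate_succ_apply']; exact hP _ _ ihk
    have h0 := h 0 W hW
    rw [Fin.castSucc_zero] at h0
    -- The exponent from the first expansion becomes the first entry of the multi-index; the
    -- remaining operators are handled by induction.
    rw [h0, ← (Fin.consEquiv fun _ => Fin N).sum_comp, Fintype.sum_prod_type, Finset.sum_range]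
    refine Finset.sum_congr rfl fun k _ => ?_
    have := ih (fun j => T j.succ) (fun j => c j.succ) (fun j => Φ j.succ)
      (fun j W => hP j.succ W) (fun j W hW => by rw [Fin.succ_castSucc]; exact h j.succ W hW)
      _ (hit k)
    rw [Fin.succ_zero_eq_one] at this ⊢
    rw [this, Finset.smul_sum]
    refine Finset.sum_congr rfl fun α _ => ?_
    rw [List.finRange_succ, smul_smul, Fin.prod_univ_succ]
    simp [Fin.consEquiv, List.foldl_map]

/-! ### Extremal polynomials through the adjoint representation -/

section FreeGroup

variable {r s n : ℕ} {e : Fin n → FreeMagma (Fin r)} {F : LieGroupLaw n}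

/-- The homogeneous left invariant fields of degree `k`, for the weights of the Hall basis `e`. -/
def IsHomogLeft (e : Fin n → FreeMagma (Fin r)) (F : LieGroupLaw n) (k : ℕ)
    (W : Vec n → Vec n) : Prop :=
  W ∈ F.lieAlg ∧ IsHomogField (fun j => (e j).length) k W

lemma IsHomogLeft.lieBracket {k k' : ℕ} {V W : Vec n → Vec n} (hV : IsHomogLeft e F k V)
    (hW : IsHomogLeft e F k' W) : IsHomogLeft e F (k + k') (VectorField.lieBracket ℝ V W) :=
  ⟨LieGroupLaw.lieBracket_mem hV.1 hW.1, hV.2.lieBracket hW.2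
    (LieGroupLaw.contDiff_of_mem hV.1) (LieGroupLaw.contDiff_of_mem hW.1)⟩

/-- Nilpotency in the form used throughout: no coordinate has weight above `s`, so the value at `0`
vanishes, and it determines the field. -/
lemma IsHomogLeft.eq_zero {k : ℕ} {W : Vec n → Vec n} (hW : IsHomogLeft e F k W)
    (he : IsHallBasis r s n e) (hs : 1 ≤ s) (hk : s < k) : W = 0 :=
  LieGroupLaw.eq_of_apply_zero hW.1 F.lieAlg.zero_mem
    (hW.2.apply_zero fun l => (he.length_le hs l).trans_lt hk)

lemma IsHallBasis.isHomogLeft_hggField (he : IsHallBasis r s n e)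
    (hF : IsFreeNilpotentLaw e F) (i : Fin n) :
    IsHomogLeft e F (e i).length (hggField e i) :=
  ⟨hF i, he.isHomogField_bracketField (e i)⟩

lemma IsHomogLeft.iterate {k : ℕ} {W : Vec n → Vec n} (hW : IsHomogLeft e F k W)
    (he : IsHallBasis r s n e) (hF : IsFreeNilpotentLaw e F) (j : Fin n) (a : ℕ) :
    IsHomogLeft e F (k + a * (e j).length)
      ((fun U => VectorField.lieBracket ℝ U (hggField e j))^[a] W) := by
  induction a with
  | zero => simpa using hW
  | succ a ih =>
    rw [Function.iterate_succ_apply', add_mul, one_mul, ← add_assoc]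
    exact ih.lieBracket (he.isHomogLeft_hggField hF j)

lemma IsHomogLeft.iterBracket {k : ℕ} {W : Vec n → Vec n} (hW : IsHomogLeft e F k W)
    (he : IsHallBasis r s n e) (hF : IsFreeNilpotentLaw e F) (α : Fin n → ℕ) :
    IsHomogLeft e F (k + ∑ j, α j * (e j).length) (iterBracket (hggField e) W α) := by
  rw [Fin.sum_univ_def]
  unfold _root_.iterBracket
  induction List.finRange n generalizing k W with
  | nil => simpa using hW
  | cons j l ih =>
    simpa [add_assoc] using ih (hW.iterate he hF j (α j))

lemma IsHallBasis.hggField_zero (he : IsHallBasis r s n e) (i : Fin n) :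
    hggField e i 0 = Pi.single i 1 := he.hggField_eq_single fun _ _ => rfl

/-- A left invariant field is the combination of the basis with coefficients its value at `0`. -/
lemma IsHallBasis.eq_sum_hggField (he : IsHallBasis r s n e) (hF : IsFreeNilpotentLaw e F)
    {W : Vec n → Vec n} (hW : W ∈ F.lieAlg) : W = ∑ k, W 0 k • hggField e k := by
  refine LieGroupLaw.eq_of_apply_zero hW
    (F.lieAlg.sum_mem fun k _ => F.lieAlg.smul_mem _ (hF k)) ?_
  simp only [Finset.sum_apply, Pi.smul_apply, he.hggField_zero]
  exact pi_eq_sum_univ' (W 0)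

/-- At the origin the basis fields are the coordinate vectors, so evaluating there reads off the
coefficients whichever ones were chosen. -/
lemma IsHallBasis.frameCoeff_eq (he : IsHallBasis r s n e) (hF : IsFreeNilpotentLaw e F)
    {W : Vec n → Vec n} (hW : W ∈ F.lieAlg) : frameCoeff (hggField e) W = W 0 := by
  have h : ∃ c : Fin n → ℝ, W = ∑ k, c k • hggField e k := ⟨_, he.eq_sum_hggField hF hW⟩
  rw [frameCoeff, dif_pos h]
  have hc := congrFun h.choose_spec 0
  simp only [Finset.sum_apply, Pi.smul_apply, he.hggField_zero] at hc
  rw [hc]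
  exact pi_eq_sum_univ' _

/-- Moving one coordinate to `0`, when those before it vanish, expands `Ad` in brackets. -/
lemma IsHallBasis.Ad_eq_sum (he : IsHallBasis r s n e) (hs : 1 ≤ s)
    (hF : IsFreeNilpotentLaw e F) {k : ℕ} {W : Vec n → Vec n} (hW : IsHomogLeft e F k W)
    (j : Fin n) (x : Vec n) (hx : ∀ i < j, x i = 0) :
    F.Ad x (W 0) = ∑ a ∈ Finset.range (s + 1), ((-x j) ^ a / (a.factorial : ℝ)) •
      F.Ad (Function.update x j 0)
        ((fun U => VectorField.lieBracket ℝ U (hggField e j))^[a] W 0) := by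
  set y : Vec n := Function.update x j 0 with hy
  have hpath : ∀ t : ℝ, ∀ i < j, (y + t • (Pi.single j 1 : Vec n)) i = 0 := fun t i hi => by
    simp [hy, hi.ne, hx i hi]
  have h := eq_sum_of_hasDerivAt_neg (s + 1) (fun a t => F.Ad (y + t • Pi.single j 1)
    ((fun U => VectorField.lieBracket ℝ U (hggField e j))^[a] W 0)) (fun a t => ?_) (fun t => ?_)
    (x j)
  · have hx' : y + x j • (Pi.single j 1 : Vec n) = x := by
      funext i
      by_cases hi : i = j
      · subst hi; simp [hy]
      · simp [hy, hi]
    simpa only [hx', zero_smul, add_zero, Function.iterate_zero, id] using h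
  · have hU := (hW.iterate he hF j a).1
    have hl : HasDerivAt (fun t : ℝ => y + t • (Pi.single j 1 : Vec n)) (Pi.single j 1) t := by
      simpa using ((hasDerivAt_id t).smul_const (Pi.single j 1 : Vec n)).const_add y
    have hd := ((F.contDiff_Ad_apply
      ((fun U => VectorField.lieBracket ℝ U (hggField e j))^[a] W 0)).differentiable (by simp)
      (y + t • Pi.single j 1)).hasFDerivAt.comp_hasDerivAt t hl
    -- On this line the velocity `∂_j` is `Y_j`. Passing from `[Y_j, U]` to `[U, Y_j]` gives the
    -- sign required by the Taylor formula.
    have hval := LieGroupLaw.fderiv_Ad_apply (hF j) hU (y + t • (Pi.single j 1 : Vec n))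
    rw [he.hggField_eq_single (hpath t), VectorField.lieBracket_swap,
      map_neg] at hval
    rw [hval] at hd
    rw [Function.iterate_succ_apply']
    exact hd
  · have hz := (hW.iterate he hF j (s + 1)).eq_zero he hs (by
      have := Nat.mul_le_mul_left (s + 1) (e j).length_pos
      omega)
    simp only [hz, Pi.zero_apply, map_zero]

/-- In the coordinates of the Hall basis, `Ad` is the ordered product of exponentials. -/
lemma IsHallBasis.Ad_eq_sum_iterBracket (he : IsHallBasis r s n e) (hs : 1 ≤ s)
    (hF : IsFreeNilpotentLaw e F) {k : ℕ} {W : Vec n → Vec n} (hW : IsHomogLeft e F k W)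
    (x : Vec n) :
    F.Ad x (W 0) = ∑ α : Fin n → Fin (s + 1), signedMonom (fun j => (α j : ℕ)) x •
      iterBracket (hggField e) W (fun j => (α j : ℕ)) 0 := by
  -- The `j`-th intermediate point has its first `j` coordinates set to `0`, leading from `x` to the
  -- origin, where `Ad` is the identity.
  have h := sum_foldl_iterate (s + 1) (P := fun W => ∃ k, IsHomogLeft e F k W)
    (fun j U => VectorField.lieBracket ℝ U (hggField e j))
    (fun j a => (-x j) ^ a / (a.factorial : ℝ))
    (fun j W => F.Ad (fun i : Fin n => if (i : ℕ) < j then 0 else x i) (W 0))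
    (fun j W ⟨k, hk⟩ => ⟨_, hk.lieBracket (he.isHomogLeft_hggField hF j)⟩)
    (fun j W ⟨k, hk⟩ => ?_) W ⟨k, hW⟩
  · have h0 : (fun i : Fin n => if (i : ℕ) < (0 : Fin (n + 1)) then 0 else x i) = x := by
      simp
    have hlast : (fun i : Fin n => if (i : ℕ) < Fin.last n then 0 else x i) = 0 := by
      funext i; simp
    simp only [h0, hlast, F.Ad_zero] at h
    exact h
  · have hz := he.Ad_eq_sum hs hF hk j (fun i : Fin n => if (i : ℕ) < j.castSucc then 0 else x i)
      (fun i hi => by simp [hi])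
    have hupd : Function.update (fun i : Fin n => if (i : ℕ) < j.castSucc then 0 else x i) j 0 =
        fun i : Fin n => if (i : ℕ) < j.succ then 0 else x i := by
      funext i
      by_cases hi : i = j
      · subst hi; simp
      · have : (i : ℕ) ≠ j := fun h => hi (Fin.ext h)
        simp only [Function.update_of_ne hi, Fin.val_castSucc, Fin.val_succ]
        congr 1
        simp only [eq_iff_iff]
        omega
    rw [hupd] at hz
    simpa using hz

/-- The structure constants are the coordinates of `[Y_i, Y_α]` at `0`, so the defining sum is the
expansion of `Ad` paired with `v`. -/
lemma IsHallBasis.extremalPoly_eq (he : IsHallBasis r s n e) (hs : 1 ≤ s)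
    (hF : IsFreeNilpotentLaw e F) (v : Vec n) (i : Fin n) (x : Vec n) :
    extremalPoly (hggField e) v i x = pair v (F.Ad x (hggField e i 0)) := by
  classical
  have hY := he.isHomogLeft_hggField hF i
  have hcoeff : ∀ α : Fin n → ℕ, extremalCoeff (hggField e) i α v * monom α x =
      signedMonom α x * pair v (iterBracket (hggField e) (hggField e i) α 0) := by
    intro α
    rw [signedMonom_eq, extremalCoeff, pair]
    simp only [genStructConst, he.frameCoeff_eq hF (hY.iterBracket he hF α).1, mul_comm (v _)]
    ring
  have hinj : Function.Injective fun (α : Fin n → Fin (s + 1)) j => (α j : ℕ) :=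
    fun α β h => funext fun j => Fin.ext (congrFun h j)
  rw [extremalPoly, finsum_eq_sum_of_support_subset (s := Finset.univ.image
    fun (α : Fin n → Fin (s + 1)) j => (α j : ℕ)), Finset.sum_image hinj.injOn,
    he.Ad_eq_sum_iterBracket hs hF hY]
  · simp only [hcoeff, pair, Finset.sum_apply, Pi.smul_apply, smul_eq_mul, Finset.mul_sum]
    rw [Finset.sum_comm]
    refine Finset.sum_congr rfl fun j _ => Finset.sum_congr rfl fun α _ => ?_
    ring
  · intro α hα
    by_contra hnot
    -- Outside the box `α_j ≤ s` the iterated bracket has degree above `s` and vanishes, so the sum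
    -- over all multi-indices is the finite one.
    have hex : ∃ j, s + 1 ≤ α j := by
      by_contra! hcon
      exact hnot (by
        simp only [Finset.coe_image, Finset.coe_univ, image_univ, mem_range]
        exact ⟨fun j => ⟨α j, hcon j⟩, rfl⟩)
    obtain ⟨j, hj⟩ := hex
    have hdeg : s < (e i).length + ∑ j, α j * (e j).length := by
      have h1 := Finset.single_le_sum (f := fun j => α j * (e j).length)
        (fun _ _ => Nat.zero_le _) (Finset.mem_univ j)
      have h2 := Nat.le_mul_of_pos_right (α j) (e j).length_pos
      omega
    have hz := (hY.iterBracket he hF α).eq_zero he hs hdeg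
    apply hα
    simp only [hcoeff, hz]
    simp [pair]

end FreeGroup

/-! ### Dual curves -/

section DualCurve

lemma pair_sum_left {m : ℕ} {ι : Type*} (S : Finset ι) (c : ι → ℝ) (ξ : ι → Vec m) (w : Vec m) :
    pair (∑ i ∈ S, c i • ξ i) w = ∑ i ∈ S, c i * pair (ξ i) w := by
  simp only [pair, Finset.sum_apply, Pi.smul_apply, smul_eq_mul, Finset.mul_sum, Finset.sum_mul]
  rw [Finset.sum_comm]
  exact Finset.sum_congr rfl fun i _ => Finset.sum_congr rfl fun k _ => by ring

lemma pair_sum_right {m : ℕ} {ι : Type*} (S : Finset ι) (c : ι → ℝ) (ξ : Vec m) (w : ι → Vec m) :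
    pair ξ (∑ i ∈ S, c i • w i) = ∑ i ∈ S, c i * pair ξ (w i) := by
  simp only [pair, Finset.sum_apply, Pi.smul_apply, smul_eq_mul, Finset.mul_sum]
  rw [Finset.sum_comm]
  exact Finset.sum_congr rfl fun i _ => Finset.sum_congr rfl fun k _ => by ring

lemma pair_sub_right {m : ℕ} (ξ u w : Vec m) : pair ξ (u - w) = pair ξ u - pair ξ w := by
  simp [pair, mul_sub]

lemma contDiff_pair {m : ℕ} : ContDiff ℝ ∞ fun p : Vec m × Vec m => pair p.1 p.2 := by
  unfold pair
  fun_prop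

/-- A smooth function of a Lipschitz curve is absolutely continuous. -/
lemma ContDiff.absolutelyContinuous_comp {E : Type*} [NormedAddCommGroup E] [NormedSpace ℝ E]
    [FiniteDimensional ℝ E] {g : E → ℝ} (hg : ContDiff ℝ ∞ g) {c : ℝ → E} {K : ℝ≥0} {a b : ℝ}
    (hc : LipschitzOnWith K c (uIcc a b)) :
    AbsolutelyContinuousOnInterval (fun t => g (c t)) a b := by
  have : ProperSpace E := FiniteDimensional.proper ℝ E
  -- The curve stays in a ball, on which a smooth function is Lipschitz.
  obtain ⟨R, hR⟩ := (isCompact_uIcc.image_of_continuousOn hc.continuousOn).isBounded.subset_closedBall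
    (0 : E)
  obtain ⟨L, hL⟩ := hg.contDiffOn.exists_lipschitzOnWith (s := Metric.closedBall (0 : E) R)
    (by simp) (convex_closedBall _ _) (isCompact_closedBall _ _)
  exact (hL.comp hc fun t ht => hR (mem_image_of_mem c ht)).absolutelyContinuousOnInterval

/-- The derivative of a dual curve paired with a vector field. -/
lemma hasDerivAt_pair_dual {m r : ℕ} {X : Fin r → Vec m → Vec m} {Z : Vec m → Vec m}
    (hX : ∀ j, ContDiff ℝ ∞ (X j)) (hZ : ContDiff ℝ ∞ Z) {γ ξ : ℝ → Vec m} {c : Fin r → ℝ} {t : ℝ}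
    (hγ : HasDerivAt γ (∑ j, c j • X j (γ t)) t)
    (hξ : ∀ k, HasDerivAt (fun τ => ξ τ k)
      (-∑ j, ∑ i, fderiv ℝ (fun x => X j x i) (γ t) (Pi.single k 1) * c j * ξ t i) t) :
    HasDerivAt (fun τ => pair (ξ τ) (Z (γ τ)))
      (∑ j, c j * pair (ξ t) (VectorField.lieBracket ℝ (X j) Z (γ t))) t := by
  have hd := fun j => (hX j).differentiable (by simp) (γ t)
  have hZγ := ((hZ.differentiable (by simp) (γ t)).hasFDerivAt.comp_hasDerivAt t hγ)
  have h : HasDerivAt (fun τ => pair (ξ τ) (Z (γ τ))) _ t :=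
    HasDerivAt.fun_sum (u := Finset.univ) fun k _ => (hξ k).mul (hasDerivAt_pi.1 hZγ k)
  convert h using 1
  have hcoord : ∀ j i k, fderiv ℝ (fun x => X j x i) (γ t) (Pi.single k 1) =
      fderiv ℝ (X j) (γ t) (Pi.single k 1) i := fun j i k =>
    congrArg (fun T : Vec m →L[ℝ] ℝ => T (Pi.single k 1)) (fderiv_apply (hd j) i)
  have hlin : ∀ j i, fderiv ℝ (X j) (γ t) (Z (γ t)) i =
      ∑ k, Z (γ t) k * fderiv ℝ (X j) (γ t) (Pi.single k 1) i := fun j i => by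
    conv_lhs => rw [pi_eq_sum_univ' (Z (γ t)), map_sum, Finset.sum_apply]
    refine Finset.sum_congr rfl fun k _ => ?_
    rw [map_smul]
    rfl
  -- The adjoint equation supplies the term `-DX_j Z` of the bracket `[X_j, Z]`, and the motion of
  -- the base point supplies `DZ X_j`.
  have h1 : ∑ k, (-∑ j, ∑ i, fderiv ℝ (fun x => X j x i) (γ t) (Pi.single k 1) * c j * ξ t i) *
      Z (γ t) k = -∑ j, c j * pair (ξ t) (fderiv ℝ (X j) (γ t) (Z (γ t))) := by
    simp only [neg_mul, Finset.sum_neg_distrib, neg_inj, pair, Finset.sum_mul, hlin,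
      Finset.mul_sum, hcoord]
    rw [Finset.sum_comm]
    refine Finset.sum_congr rfl fun j _ => ?_
    rw [Finset.sum_comm]
    exact Finset.sum_congr rfl fun i _ => Finset.sum_congr rfl fun k _ => by ring
  have h2 : ∑ k, ξ t k * fderiv ℝ Z (γ t) (∑ j, c j • X j (γ t)) k =
      ∑ j, c j * pair (ξ t) (fderiv ℝ Z (γ t) (X j (γ t))) := by
    rw [map_sum]
    simp only [map_smul]
    exact pair_sum_right Finset.univ c (ξ t) _
  rw [Finset.sum_add_distrib]
  refine Eq.trans ?_ (congrArg₂ (· + ·) h1.symm h2.symm)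
  simp only [VectorField.lieBracket, pair_sub_right, mul_sub, Finset.sum_sub_distrib]
  ring

variable {r s n m : ℕ} {e : Fin n → FreeMagma (Fin r)} {F : LieGroupLaw n} {G : LieGroupLaw m}
  {π : Vec n → Vec m}

lemma IsHallBasis.isHomogLeft_ggField (he : IsHallBasis r s n e) (hF : IsFreeNilpotentLaw e F)
    (a : Fin r) : IsHomogLeft e F 1 (ggField e a) := by
  obtain ⟨i, -, hi⟩ := he.gen a
  have h := he.isHomogLeft_hggField hF i
  unfold hggField at h
  rw [hi] at h
  exact h

/-- The projected field depends only on `W 0`, whose coordinates are its coefficients in the values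
of the basis fields at `0`. -/
lemma pushLie_eq_sum (he : IsHallBasis r s n e) (W : Vec n → Vec n) (y : Vec m) :
    pushLie G π W y = ∑ k, W 0 k • pushLie G π (hggField e k) y := by
  simp only [pushLie, he.hggField_zero]
  conv_lhs => rw [pi_eq_sum_univ' (W 0), map_sum, map_sum]
  simp only [map_smul]

/-- Along an extremal, the dual curve paired with a projected field is `Ad` along the lift,
paired with the initial covector. -/
lemma pair_dual_eq_pair_Ad (he : IsHallBasis r s n e) (hs : 1 ≤ s) (hF : IsFreeNilpotentLaw e F)
    (hπ : IsLieGroupHom F G π) {γ ξ : ℝ → Vec m} {κ : ℝ → Vec n} {h : ℝ → Fin r → ℝ} {ξ₀ : ℝ}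
    (hγ : IsHorizontal (fun a => pushLie G π (ggField e a)) γ h)
    (hκ : IsHorizontal (ggField e) κ h) (hκ0 : κ 0 = 0)
    (hξ : IsDualCurve (fun a => pushLie G π (ggField e a)) γ h ξ₀ ξ) (N k : ℕ)
    {W : Vec n → Vec n} (hW : IsHomogLeft e F k W) (hk : s < k + N) {t : ℝ}
    (ht : t ∈ Icc (0 : ℝ) 1) :
    pair (ξ t) (pushLie G π W (γ t)) =
      pair (fun i => pair (ξ 0) (pushLie G π (hggField e i) (γ 0))) (F.Ad (κ t) (W 0)) := by
  -- `N` bounds the number of further brackets with generators before the degree passes `s`. The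
  -- statement for `[Y_a, W]`, of degree `1 + k`, makes the two derivatives agree almost everywhere.
  induction N generalizing k W t with
  | zero =>
    rw [hW.eq_zero he hs hk]
    simp [pushLie, pair]
  | succ N ih =>
    set v : Vec n := fun i => pair (ξ 0) (pushLie G π (hggField e i) (γ 0)) with hv
    have hX : ∀ U, ContDiff ℝ ∞ (pushLie G π U) := fun U =>
      LieGroupLaw.contDiff_of_mem (G := G) (pushLie_mem U)
    have hA : ContDiff ℝ ∞ fun x => pair v (F.Ad x (W 0)) :=
      contDiff_pair.comp (contDiff_const.prodMk (F.contDiff_Ad_apply (W 0)))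
    have hI : uIcc (0 : ℝ) 1 = Icc 0 1 := uIcc_of_le zero_le_one
    have hac : AbsolutelyContinuousOnInterval
        (fun τ => pair (ξ τ) (pushLie G π W (γ τ)) - pair v (F.Ad (κ τ) (W 0))) 0 1 := by
      obtain ⟨K₁, h₁⟩ := hγ.lipschitz
      obtain ⟨K₂, h₂⟩ := hξ.lipschitz
      obtain ⟨K₃, h₃⟩ := hκ.lipschitz
      rw [← hI] at h₁ h₂ h₃
      have hg : ContDiff ℝ ∞ fun p : Vec m × Vec m => pair p.1 (pushLie G π W p.2) :=
        contDiff_pair.comp (contDiff_fst.prodMk ((hX W).comp contDiff_snd))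
      exact (hg.absolutelyContinuous_comp (h₂.prodMk h₁)).sub (hA.absolutelyContinuous_comp h₃)
    have hae : ∀ᵐ τ, τ ∈ uIcc (0 : ℝ) 1 → HasDerivAt
        (fun τ => pair (ξ τ) (pushLie G π W (γ τ)) - pair v (F.Ad (κ τ) (W 0))) 0 τ := by
      rw [hI, ← ae_restrict_iff' measurableSet_Icc]
      filter_upwards [hγ.deriv, hκ.deriv, ae_all_iff.2 hξ.adjoint,
        ae_restrict_mem measurableSet_Icc] with τ h₁ h₂ h₃ hτ
      have hΛ := hasDerivAt_pair_dual (fun a => hX (ggField e a)) (hX W) h₁ h₃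
      have hp := (hA.differentiable (by simp) (κ τ)).hasFDerivAt.comp_hasDerivAt τ h₂
      refine (hΛ.sub hp).congr_deriv ?_
      rw [sub_eq_zero, map_sum]
      refine Finset.sum_congr rfl fun a _ => ?_
      have hYa := he.isHomogLeft_ggField hF a
      have hAd : fderiv ℝ (fun x => pair v (F.Ad x (W 0))) (κ τ) (ggField e a (κ τ)) =
          pair v (F.Ad (κ τ) (VectorField.lieBracket ℝ (ggField e a) W 0)) := by
        rw [← LieGroupLaw.fderiv_Ad_apply hYa.1 hW.1]
        let T : Vec n →L[ℝ] ℝ := ∑ i, v i • ContinuousLinearMap.proj i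
        have hT : ∀ w, pair v w = T w := fun w => by simp [T, pair]
        have hc : HasFDerivAt (fun x => T (F.Ad x (W 0)))
            (T.comp (fderiv ℝ (fun x => F.Ad x (W 0)) (κ τ))) (κ τ) :=
          T.hasFDerivAt.comp _ (((F.contDiff_Ad_apply (W 0)).differentiable (by simp) _).hasFDerivAt)
        simp only [hT]
        rw [hc.fderiv]
        rfl
      rw [map_smul, smul_eq_mul, hAd, ← hπ.pushLie_lieBracket hYa.1 hW.1,
        ih (1 + k) (hYa.lieBracket hW) (by omega) hτ]
    obtain ⟨C, hC⟩ := hac.const_of_ae_hasDerivAt_zero hae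
    rw [hI] at hC
    have h0 := hC 0 (by simp)
    -- Since `κ(0) = 0` and `Ad` is the identity there, the difference starts at `0` by the choice
    -- of `v`.
    have hinit : pair (ξ 0) (pushLie G π W (γ 0)) = pair v (W 0) := by
      rw [pushLie_eq_sum he W, pair_sum_right]
      simp only [hv, pair, mul_comm]
    rw [hκ0, F.Ad_zero, ContinuousLinearMap.id_apply, hinit, sub_self] at h0
    rw [← sub_eq_zero, hC t ht, h0]

end DualCurve

/-! ### Extremals and extremal polynomials -/

theorem mainTheorem6 (r s n m : ℕ) (hr : 2 ≤ r) (hs : 2 ≤ s)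
    -- the free nilpotent group of rank `r` and step `s`
    (e : Fin n → FreeMagma (Fin r)) (he : IsHallBasis r s n e)
    (F : LieGroupLaw n) (hF : IsFreeNilpotentLaw e F)
    -- the stratified group of rank `r` and step `s`
    (G : LieGroupLaw m) (V : ℕ → Submodule ℝ (Vec m → Vec m))
    (hG : G.IsStratification r s V)
    -- the projection
    (π : Vec n → Vec m) (hπ : IsLieGroupHom F G π) (hπ_surj : Function.Surjective π)
    (hπ_gen : ∀ a : Fin r, pushLie G π (ggField e a) ∈ V 1)
    -- the basis of the Lie algebra of `G` chosen among the projected fields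
    (σ : Fin m → Fin n) (hσ : StrictMono σ)
    (hσ_indep : LinearIndependent ℝ fun j => pushLie G π (hggField e (σ j)))
    (hσ_span : Submodule.span ℝ (Set.range fun j => pushLie G π (hggField e (σ j))) = G.lieAlg)
    (ζ : Fin n → Fin m → ℝ)
    (hζ : ∀ i, pushLie G π (hggField e i) = ∑ j, ζ i j • pushLie G π (hggField e (σ j)))
    (θ : Fin m → Vec m → Vec m)
    (hθ : IsDualFrame (fun j => pushLie G π (hggField e (σ j))) θ)
    -- the horizontal curve and its lift
    (γ : ℝ → Vec m) (κ : ℝ → Vec n) (h : ℝ → Fin r → ℝ)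
    (hγ : IsHorizontal (fun a => pushLie G π (ggField e a)) γ h) (hγ0 : γ 0 = 0)
    (hκ : IsHorizontal (ggField e) κ h) (hκ0 : κ 0 = 0)
    -- the dual curve and its coordinates in the frame `θ`
    (ξ₀ : ℝ) (ξ : ℝ → Vec m)
    (hξ : IsDualCurve (fun a => pushLie G π (ggField e a)) γ h ξ₀ ξ)
    (lam : ℝ → Vec m)
    (hlam : ∀ t ∈ Icc (0 : ℝ) 1, ξ t = ∑ i, lam t i • θ i (γ t)) :
    ∃ v : Vec n, (∀ i, v i = ∑ j, ζ i j * v (σ j)) ∧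
      ∀ i, ∀ t ∈ Icc (0 : ℝ) 1, lam t i = extremalPoly (hggField e) v (σ i) (κ t) := by
  have hs1 : 1 ≤ s := by omega
  refine ⟨fun i => pair (ξ 0) (pushLie G π (hggField e i) (γ 0)), fun i => ?_, fun i t ht => ?_⟩
  · change pair (ξ 0) (pushLie G π (hggField e i) (γ 0)) = _
    conv_lhs => rw [hζ i, Finset.sum_apply]
    exact pair_sum_right Finset.univ (ζ i) (ξ 0) _
  · have hlamt : lam t i = pair (ξ t) (pushLie G π (hggField e (σ i)) (γ t)) := by
      rw [hlam t ht, pair_sum_left]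
      simp [hθ _ i (γ t)]
    rw [hlamt, he.extremalPoly_eq hs1 hF]
    -- `N = s` suffices because every basis field has degree at least `1`.
    exact pair_dual_eq_pair_Ad he hs1 hF hπ hγ hκ hκ0 hξ s _
      (he.isHomogLeft_hggField hF (σ i)) (by have := (e (σ i)).length_pos; omega) ht
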